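/- Let $n\ge 3$, let $m_1,\dots,m_n>0$ be masses, let $m_{ij}=m_{ji}$ ($i\ne j$) be real coefficients and let $\alpha\in\mathbb{R}$. Let $\mathcal{X}_{\mathbb R}=\{z\in\mathbb{R}^n : \sum_i m_iz_i=0\}$, let $\mathbb{RP}^{n-2}$ be the projective space of lines in $\mathcal{X}_{\mathbb R}$, and let $X^C\subset\mathbb{RP}^{n-2}$ be the open set of collinear configurations, i.e. of the points $[z_1:\dots:z_n]$ with $z_i\neq z_j$ for all $i\ne j$. The collinear self-map $f^C\colon X^C\to\mathbb{RP}^{n-2}$ is defined by $f^C[z]=[w]$, where $$w_i=\sum_{j\ne i} m_i^{-1}m_{ij}\,|z_i-z_j|^{\alpha}(z_i-z_j),\qquad i=1,\dots,n;$$ it is the restriction to real points of the self-map $f$ given by the same formula on the planar configurations in $\mathbb{CP}^{n-2}$. (If all $m_{ij}$ are positive, then $w\neq0$, so $f^C$ is defined on all of $X^C$.) Suppose that $m_{ij}>0$ for all $i<j$ and that $\alpha<-1$. Then $X^C$ has exactly $n!/2$ connected components, and on each component $V$ of $X^C$ the map $f^C|_V\colon V\to\mathbb{RP}^{n-2}$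 is compactly fixed (its set of fixed points in $V$ is compact) and its fixed point index is $1$. Here the fixed point index is normalized in the usual way: a nondegenerate fixed point $x$ of a $C^1$ map $g$ contributes $\operatorname{sign}\det(1-Dg(x))$. -/

import Mathlib

open scoped LinearAlgebra.Projectivization

noncomputable section

/-! ## Topology of projective spaces and affine charts -/

/-- The projectivization of a topological vector space carries the quotient topology. -/
instance instTopologicalSpaceProjectivization {K V : Type*} [DivisionRing K] [AddCommGroup V]
    [Module K V] [TopologicalSpace V] : TopologicalSpace (ℙ K V) :=
  TopologicalSpace.coinduced (Projectivization.mk' K) inferInstance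

/-- An affine chart of the real projective space `ℙ ℝ W`: a linear form, whose non-vanishing locus
is the domain of the chart, and an origin on the affine hyperplane `form = 1`. -/
structure AffineChart (W : Type*) [AddCommGroup W] [Module ℝ W] where
  form : W →ₗ[ℝ] ℝ
  base : W
  form_base : form base = 1

namespace AffineChart

variable {W : Type*} [AddCommGroup W] [Module ℝ W] (c : AffineChart W)

/-- The vector space on which the chart is modelled. -/
abbrev Model : Type _ := LinearMap.ker c.form

/-- The complement of the projective hyperplane `form = 0`. -/
def domain : Set (ℙ ℝ W) := {p | c.form p.rep ≠ 0}

/-- The affine coordinate of `[w]`, that is `w / form w - base` (used on `c.domain` only;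
the factor `(form w)⁻¹ * form w`, which is `1` there, makes it an element of `ker form` everywhere). -/
def coord (p : ℙ ℝ W) : c.Model :=
  ⟨(c.form p.rep)⁻¹ • p.rep - ((c.form p.rep)⁻¹ * c.form p.rep) • c.base, by
    simp [LinearMap.mem_ker, c.form_base]⟩

theorem base_add_ne_zero (v : c.Model) : c.base + (v : W) ≠ 0 := by
  intro h
  have h1 : c.form (c.base + (v : W)) = 1 := by
    rw [map_add, c.form_base, LinearMap.mem_ker.1 v.2, add_zero]
  rw [h, map_zero] at h1
  exact zero_ne_one h1

/-- The point `[base + v]` with affine coordinate `v`. -/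
def point (v : c.Model) : ℙ ℝ W := Projectivization.mk ℝ (c.base + (v : W)) (c.base_add_ne_zero v)

theorem mk_mem_domain {w : W} (hw : w ≠ 0) :
    Projectivization.mk ℝ w hw ∈ c.domain ↔ c.form w ≠ 0 := by
  obtain ⟨a, ha⟩ := Projectivization.exists_smul_eq_mk_rep ℝ w hw
  have ha0 : (a : ℝ) ≠ 0 := a.ne_zero
  simp [domain, ← ha, Units.smul_def, ha0]

theorem coord_mk {w : W} (hw : w ≠ 0) (h : c.form w ≠ 0) :
    (c.coord (Projectivization.mk ℝ w hw) : W) = (c.form w)⁻¹ • w - c.base := by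
  obtain ⟨a, ha⟩ := Projectivization.exists_smul_eq_mk_rep ℝ w hw
  have ha0 : (a : ℝ) ≠ 0 := a.ne_zero
  have h2 : (a : ℝ) * c.form w ≠ 0 := mul_ne_zero ha0 h
  simp only [coord, ← ha, Units.smul_def, map_smul, smul_eq_mul, inv_mul_cancel₀ h2, one_smul,
    smul_smul]
  congr 2
  field_simp

theorem point_mem_domain (v : c.Model) : c.point v ∈ c.domain := by
  rw [point, mk_mem_domain, map_add, c.form_base, LinearMap.mem_ker.1 v.2, add_zero]
  exact one_ne_zero

theorem coord_point (v : c.Model) : c.coord (c.point v) = v := by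
  have h : c.form (c.base + (v : W)) = 1 := by
    rw [map_add, c.form_base, LinearMap.mem_ker.1 v.2, add_zero]
  apply Subtype.ext
  rw [point, coord_mk _ _ (by rw [h]; exact one_ne_zero), h]
  simp

theorem point_coord {p : ℙ ℝ W} (hp : p ∈ c.domain) : c.point (c.coord p) = p := by
  induction p with
  | h w hw =>
    have h := (c.mk_mem_domain hw).1 hp
    rw [point, Projectivization.mk_eq_mk_iff']
    exact ⟨(c.form w)⁻¹, by rw [coord_mk _ hw h]; abel⟩

end AffineChart

/-! ## The fixed point index -/

/-- `HasFixedPointIndexOn g U k`: the `C¹` map `g`, defined on the open subset `U` of the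
finite-dimensional real vector space `E`, has a compact set of fixed points, and its fixed point
index on `U` is `k`.  The index is the Brouwer degree at `0` of `x ↦ x - g x` near the fixed point
set: on a compact neighbourhood `K` of the fixed point set, the signs of `det (1 - Dg(x))` at the
solutions `x ∈ K` of `x - g x = y` add up to `k` for every regular value `y` close to `0`.  There
are regular values arbitrarily close to `0` by Sard's theorem, so `k` is determined; see
`HasFixedPointIndexOn.unique`. -/
structure HasFixedPointIndexOn {E : Type*} [NormedAddCommGroup E] [NormedSpace ℝ E]
    (g : E → E) (U : Set E) (k : ℤ) : Prop where
  isOpen : IsOpen U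
  contDiffOn : ContDiffOn ℝ 1 g U
  isCompact_fixed : IsCompact {x | x ∈ U ∧ g x = x}
  sum_sign : ∀ K : Set E, IsCompact K → K ⊆ U → {x | x ∈ U ∧ g x = x} ⊆ interior K →
    ∀ᶠ y in nhds (0 : E),
      (∀ x ∈ K, x - g x = y → (ContinuousLinearMap.id ℝ E - fderiv ℝ g x).det ≠ 0) →
      ∑ᶠ x ∈ {x | x ∈ K ∧ x - g x = y},
        ((SignType.sign (ContinuousLinearMap.id ℝ E - fderiv ℝ g x).det : SignType) : ℤ) = k

theorem HasFixedPointIndexOn.unique {E : Type*} [NormedAddCommGroup E] [NormedSpace ℝ E]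
    [FiniteDimensional ℝ E] {g : E → E} {U : Set E} {k l : ℤ}
    (hk : HasFixedPointIndexOn g U k) (hl : HasFixedPointIndexOn g U l) : k = l := by
  obtain ⟨K, hK, hFK, hKU⟩ :=
    exists_compact_between hk.isCompact_fixed hk.isOpen (fun x hx => hx.1)
  have h1 := (hk.sum_sign K hK hKU hFK).and (hl.sum_sign K hK hKU hFK)
  obtain ⟨V, hV, hVo, h0⟩ := eventually_nhds_iff.1 h1
  let _ : MeasurableSpace E := borel E
  have : BorelSpace E := ⟨rfl⟩
  let μ : MeasureTheory.Measure E := MeasureTheory.Measure.addHaar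
  let S : Set E := {x | x ∈ U ∧ (ContinuousLinearMap.id ℝ E - fderiv ℝ g x).det = 0}
  have hS : μ ((fun x => x - g x) '' S) = 0 := by
    refine MeasureTheory.addHaar_image_eq_zero_of_det_fderivWithin_eq_zero μ
      (f' := fun x => ContinuousLinearMap.id ℝ E - fderiv ℝ g x) ?_ (fun x hx => hx.2)
    intro x hx
    have hd : DifferentiableAt ℝ g x :=
      (hk.contDiffOn.contDiffAt (hk.isOpen.mem_nhds hx.1)).differentiableAt one_ne_zero
    exact ((hasFDerivAt_id x).sub hd.hasFDerivAt).hasFDerivWithinAt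
  have hVpos : 0 < μ V := hVo.measure_pos μ ⟨0, h0⟩
  obtain ⟨y, hyV, hyS⟩ : ∃ y ∈ V, y ∉ (fun x => x - g x) '' S := by
    by_contra hcon
    push Not at hcon
    exact hVpos.ne' (MeasureTheory.measure_mono_null hcon hS)
  have hreg : ∀ x ∈ K, x - g x = y →
      (ContinuousLinearMap.id ℝ E - fderiv ℝ g x).det ≠ 0 :=
    fun x hx hxy hdet => hyS ⟨x, ⟨hKU hx, hdet⟩, hxy⟩
  exact ((hV y hyV).1 hreg).symm.trans ((hV y hyV).2 hreg)

/-- `HasFixedPointIndex f V k`: the map `f`, defined on the open subset `V` of the real projective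
space `ℙ ℝ W` and with values in `ℙ ℝ W`, is compactly fixed, and its fixed point index on `V` is
`k`, computed in the affine charts that contain its fixed points in `V`.  (Every finite set of
points lies in an affine chart.)  In a chart, `f` is considered on the open set of those points
of `V` in the chart that `f` maps into the chart; by excision the other points do not contribute. -/
structure HasFixedPointIndex {W : Type*} [NormedAddCommGroup W] [NormedSpace ℝ W]
    (f : ℙ ℝ W → ℙ ℝ W) (V : Set (ℙ ℝ W)) (k : ℤ) : Prop where
  isOpen : IsOpen V
  continuousOn : ContinuousOn f V
  isCompact_fixed : IsCompact {p | p ∈ V ∧ f p = p}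
  exists_chart : ∃ c : AffineChart W, {p | p ∈ V ∧ f p = p} ⊆ c.domain
  index_chart : ∀ c : AffineChart W, {p | p ∈ V ∧ f p = p} ⊆ c.domain →
    HasFixedPointIndexOn (fun v : c.Model => c.coord (f (c.point v)))
      {v | c.point v ∈ V ∧ f (c.point v) ∈ c.domain} k

theorem HasFixedPointIndex.unique {W : Type*} [NormedAddCommGroup W] [NormedSpace ℝ W]
    [FiniteDimensional ℝ W] {f : ℙ ℝ W → ℙ ℝ W} {V : Set (ℙ ℝ W)} {k l : ℤ}
    (hk : HasFixedPointIndex f V k) (hl : HasFixedPointIndex f V l) : k = l := by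
  obtain ⟨c, hc⟩ := hk.exists_chart
  exact (hk.index_chart c hc).unique (hl.index_chart c hc)

/-! ## The self-map of the `n`-body problem -/

/-- The data of the problem: positive masses `m i`, symmetric real coefficients `coeff i j` (only
those with `i ≠ j` matter), and the exponent `α`. -/
structure BodySystem (n : ℕ) where
  mass : Fin n → ℝ
  mass_pos : ∀ i, 0 < mass i
  coeff : Fin n → Fin n → ℝ
  coeff_symm : ∀ i j, coeff i j = coeff j i
  α : ℝ

namespace BodySystem

variable {n : ℕ} (S : BodySystem n) (𝕜 : Type*) [RCLike 𝕜]

/-- The hyperplane `∑ i, m i * z i = 0` of `𝕜ⁿ`.  For `𝕜 = ℂ` one has planar configurations, for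
`𝕜 = ℝ` collinear ones. -/
def hyperplane : Submodule 𝕜 (Fin n → 𝕜) where
  carrier := {z | ∑ i, (S.mass i : 𝕜) * z i = 0}
  add_mem' := by
    intro a b ha hb
    simp only [Set.mem_ofPred_eq] at *
    simp [mul_add, Finset.sum_add_distrib, ha, hb]
  zero_mem' := by simp
  smul_mem' := by
    intro c z hz
    simp only [Set.mem_ofPred_eq] at *
    simp [mul_left_comm _ c, ← Finset.mul_sum, hz]

/-- The configurations in projective space: the image `X` of the collision-free vectors.  For
`𝕜 = ℝ` this is the space of collinear configurations. -/
def configurations : Set (ℙ 𝕜 (S.hyperplane 𝕜)) :=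
  {p | ∃ (z : S.hyperplane 𝕜) (hz : z ≠ 0),
    (∀ i j, i ≠ j → z.1 i ≠ z.1 j) ∧ p = Projectivization.mk 𝕜 z hz}

variable {𝕜}

/-- `w i = ∑_{j ≠ i} (m i)⁻¹ * m i j * |z i - z j| ^ α * (z i - z j)`. -/
def forceVec (z : Fin n → 𝕜) (i : Fin n) : 𝕜 :=
  ∑ j ∈ Finset.univ.erase i,
    (((S.mass i)⁻¹ * S.coeff i j * ‖z i - z j‖ ^ S.α : ℝ) : 𝕜) * (z i - z j)

theorem forceVec_mem (z : Fin n → 𝕜) : S.forceVec z ∈ S.hyperplane 𝕜 := by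
  show ∑ i, (S.mass i : 𝕜) * S.forceVec z i = 0
  have h1 : ∀ i, (S.mass i : 𝕜) * S.forceVec z i =
      ∑ j, ((S.coeff i j * ‖z i - z j‖ ^ S.α : ℝ) : 𝕜) * (z i - z j) := by
    intro i
    have hm : (S.mass i : 𝕜) ≠ 0 := by exact_mod_cast (S.mass_pos i).ne'
    rw [forceVec, ← Finset.add_sum_erase _ _ (Finset.mem_univ i), sub_self, mul_zero, zero_add,
      Finset.mul_sum]
    refine Finset.sum_congr rfl fun j _ => ?_
    push_cast
    field_simp
  simp only [h1]
  have h2 : ∑ i, ∑ j, ((S.coeff i j * ‖z i - z j‖ ^ S.α : ℝ) : 𝕜) * (z i - z j) =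
      -∑ i, ∑ j, ((S.coeff i j * ‖z i - z j‖ ^ S.α : ℝ) : 𝕜) * (z i - z j) := by
    conv_lhs => rw [Finset.sum_comm]
    rw [← Finset.sum_neg_distrib]
    refine Finset.sum_congr rfl fun i _ => ?_
    rw [← Finset.sum_neg_distrib]
    refine Finset.sum_congr rfl fun j _ => ?_
    rw [S.coeff_symm j i, norm_sub_rev (z j) (z i)]
    ring
  exact self_eq_neg.1 h2

/-- The map `z ↦ w` of the hyperplane (of interest at collision-free `z`). -/
def force (z : S.hyperplane 𝕜) : S.hyperplane 𝕜 := ⟨S.forceVec z.1, S.forceVec_mem z.1⟩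

/-- For positive coefficients `force` does not vanish at a collision-free vector. -/
theorem force_ne_zero (hn : 2 ≤ n) (hpos : ∀ i j, i < j → 0 < S.coeff i j) {z : S.hyperplane 𝕜}
    (hz : ∀ i j, i ≠ j → z.1 i ≠ z.1 j) : S.force z ≠ 0 := by
  have hpos' : ∀ i j, i ≠ j → 0 < S.coeff i j := fun i j hij =>
    (lt_or_gt_of_ne hij).elim (hpos i j) fun h => S.coeff_symm i j ▸ hpos j i h
  have : Nontrivial (Fin n) := Fin.nontrivial_iff_two_le.2 hn
  obtain ⟨i, -, hi⟩ := Finset.exists_max_image (Finset.univ : Finset (Fin n)) (fun i => ‖z.1 i‖)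
    Finset.univ_nonempty
  obtain ⟨j, hj⟩ := exists_ne i
  intro h0
  have hw : S.forceVec z.1 i = 0 := congrFun (congrArg Subtype.val h0) i
  have hsum : ∑ j ∈ Finset.univ.erase i, ((S.mass i)⁻¹ * S.coeff i j * ‖z.1 i - z.1 j‖ ^ S.α) *
      RCLike.re (inner 𝕜 (z.1 i) (z.1 i - z.1 j)) = 0 := by
    have := congrArg (fun x => RCLike.re (inner 𝕜 (z.1 i) x)) hw
    simp only [forceVec, inner_sum, map_sum, inner_zero_right, map_zero] at this
    rw [← this]
    refine Finset.sum_congr rfl fun j _ => ?_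
    rw [← smul_eq_mul (_ : 𝕜), inner_smul_right, RCLike.re_ofReal_mul]
  have hterm : ∀ j ∈ Finset.univ.erase i,
      0 < ((S.mass i)⁻¹ * S.coeff i j * ‖z.1 i - z.1 j‖ ^ S.α) *
        RCLike.re (inner 𝕜 (z.1 i) (z.1 i - z.1 j)) := by
    intro j hj
    have hij : i ≠ j := (Finset.ne_of_mem_erase hj).symm
    have hd : 0 < ‖z.1 i - z.1 j‖ := norm_pos_iff.2 (sub_ne_zero.2 (hz i j hij))
    have h1 := S.mass_pos i
    have h2 := hpos' i j hij
    have h3 := hi j (Finset.mem_univ j)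
    have h4 := norm_sub_sq (𝕜 := 𝕜) (z.1 i) (z.1 j)
    have h5 : RCLike.re (inner 𝕜 (z.1 i) (z.1 i - z.1 j)) =
        ‖z.1 i‖ ^ 2 - RCLike.re (inner 𝕜 (z.1 i) (z.1 j)) := by
      rw [inner_sub_right, map_sub, inner_self_eq_norm_sq]
    have h6 : 0 < RCLike.re (inner 𝕜 (z.1 i) (z.1 i - z.1 j)) := by
      have h7 : ‖z.1 j‖ ^ 2 ≤ ‖z.1 i‖ ^ 2 := pow_le_pow_left₀ (norm_nonneg _) h3 2
      have h8 : 0 < ‖z.1 i - z.1 j‖ ^ 2 := by positivity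
      rw [h5]; linarith
    positivity
  exact (Finset.sum_pos hterm ⟨j, Finset.mem_erase.2 ⟨hj, Finset.mem_univ j⟩⟩).ne' hsum

theorem force_smul (a : 𝕜) (z : S.hyperplane 𝕜) :
    S.force (a • z) = ((‖a‖ ^ S.α : ℝ) : 𝕜) • a • S.force z := by
  apply Subtype.ext
  funext i
  show S.forceVec (a • z.1) i = ((‖a‖ ^ S.α : ℝ) : 𝕜) * (a * S.forceVec z.1 i)
  simp only [forceVec, Finset.mul_sum]
  refine Finset.sum_congr rfl fun j _ => ?_
  simp only [Pi.smul_apply, smul_eq_mul, ← mul_sub, norm_mul,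
    Real.mul_rpow (norm_nonneg _) (norm_nonneg _)]
  push_cast
  ring

open Classical in
/-- The self-map `[z] ↦ [w]` of projective space, defined where `w ≠ 0`, in particular on all
configurations if the coefficients are positive.  (Elsewhere the value is irrelevant.)
For `𝕜 = ℂ` this is the self-map `f` of the planar problem, for `𝕜 = ℝ` the map `f^C` of the
collinear one; see `selfMap_complexify`. -/
def selfMap (p : ℙ 𝕜 (S.hyperplane 𝕜)) : ℙ 𝕜 (S.hyperplane 𝕜) :=
  if h : S.force p.rep ≠ 0 then Projectivization.mk 𝕜 (S.force p.rep) h else p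

theorem selfMap_mk {z : S.hyperplane 𝕜} (hz : z ≠ 0) (h : S.force z ≠ 0) :
    S.selfMap (Projectivization.mk 𝕜 z hz) = Projectivization.mk 𝕜 (S.force z) h := by
  obtain ⟨a, ha⟩ := Projectivization.exists_smul_eq_mk_rep 𝕜 z hz
  have ha0 : (a : 𝕜) ≠ 0 := a.ne_zero
  have hr : S.force (Projectivization.mk 𝕜 z hz).rep =
      (((‖(a : 𝕜)‖ ^ S.α : ℝ) : 𝕜) * (a : 𝕜)) • S.force z := by
    rw [← ha, Units.smul_def, force_smul, smul_smul]
  have hc : ((‖(a : 𝕜)‖ ^ S.α : ℝ) : 𝕜) * (a : 𝕜) ≠ 0 :=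
    mul_ne_zero (by exact_mod_cast (Real.rpow_pos_of_pos (norm_pos_iff.2 ha0) _).ne') ha0
  have hne : S.force (Projectivization.mk 𝕜 z hz).rep ≠ 0 := by
    rw [hr]; exact smul_ne_zero hc h
  rw [selfMap, dif_pos hne, Projectivization.mk_eq_mk_iff']
  exact ⟨_, hr.symm⟩

/-- The inclusion of the real hyperplane in the complex one. -/
def complexifyVec (z : S.hyperplane ℝ) : S.hyperplane ℂ :=
  ⟨fun i => (z.1 i : ℂ), by
    show ∑ i, ((S.mass i : ℝ) : ℂ) * ((z.1 i : ℝ) : ℂ) = 0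
    have h : ∑ i, S.mass i * z.1 i = 0 := z.2
    exact_mod_cast h⟩

theorem complexifyVec_ne_zero {z : S.hyperplane ℝ} (hz : z ≠ 0) : S.complexifyVec z ≠ 0 := by
  intro h
  apply hz
  apply Subtype.ext
  funext i
  have := congrFun (congrArg Subtype.val h) i
  exact Complex.ofReal_eq_zero.1 this

/-- The inclusion of the real projective space in the complex one; its image is the set of points
fixed by the conjugation of coordinates. -/
def complexify (p : ℙ ℝ (S.hyperplane ℝ)) : ℙ ℂ (S.hyperplane ℂ) :=
  Projectivization.mk ℂ (S.complexifyVec p.rep) (S.complexifyVec_ne_zero p.rep_nonzero)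

theorem force_complexifyVec (z : S.hyperplane ℝ) :
    S.force (S.complexifyVec z) = S.complexifyVec (S.force z) := by
  apply Subtype.ext
  funext i
  show S.forceVec (fun i => (z.1 i : ℂ)) i = ((S.forceVec z.1 i : ℝ) : ℂ)
  simp only [forceVec, Complex.ofReal_sum]
  refine Finset.sum_congr rfl fun j _ => ?_
  rw [← Complex.ofReal_sub, Complex.norm_real]
  simp

/-- The collinear self-map is the restriction of the planar one. -/
theorem selfMap_complexify {p : ℙ ℝ (S.hyperplane ℝ)} (h : S.force p.rep ≠ 0) :
    S.selfMap (S.complexify p) = S.complexify (S.selfMap p) := by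
  have h2 : S.force (S.complexifyVec p.rep) ≠ 0 := by
    rw [force_complexifyVec]; exact S.complexifyVec_ne_zero h
  rw [complexify, selfMap_mk _ _ h2, selfMap, dif_pos h, complexify,
    Projectivization.mk_eq_mk_iff']
  obtain ⟨a, ha⟩ := Projectivization.exists_smul_eq_mk_rep ℝ (S.force p.rep) h
  refine ⟨((a : ℝ) : ℂ)⁻¹, ?_⟩
  have ha0 : ((a : ℝ) : ℂ) ≠ 0 := by exact_mod_cast a.ne_zero
  rw [inv_smul_eq_iff₀ ha0, force_complexifyVec, ← ha]
  apply Subtype.ext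
  funext i
  show (((a : ℝ) * (S.force p.rep).1 i : ℝ) : ℂ) = ((a : ℝ) : ℂ) * (((S.force p.rep).1 i : ℝ) : ℂ)
  push_cast
  rfl

end BodySystem

end

/-! A component of the collinear configurations is a cell: the lines spanned by vectors whose
coordinates have a prescribed order, up to reversal. Write F for `force`. It is homogeneous of
degree α + 1 and, for the mass-weighted inner product, z - F(z) is the gradient of G(z) = 1/2 ∑ mᵢ
zᵢ² + 1/2 ∑_{i≠j} mᵢⱼ Ψ(zᵢ - zⱼ), where Ψ' (t) = -|t|^α t. Since α < -1, Ψ is convex on each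
half-line, so G is strictly convex on the convex cone of vectors of one order. Everything follows
from this.

Uniqueness: two solutions of F(z) = z in one cone agree by monotonicity of the pair force
(`eq_of_forceVec_eq_self`). Existence: G attains a minimum away from the collisions
(`exists_forceVec_eq_self`). When -2 < α < -1 the function Ψ stays bounded at 0, so what keeps the
minimizer off the walls is the blow-up of the force |t|^(α+1), not of the potential
(`eventually_lt_gap`). A fixed line satisfies F(z) = l z with l > 0, and rescaling z makes l = 1;
hence each cell contains exactly one fixed point (`exists_fixedPoints_eq_singleton`).

Index: DF(z) is negative semidefinite for the mass inner product, so l⁻¹ DF(z) has no positive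
eigenvalue modulo the line of z (`exists_eq_smul_of_eq_fderiv_force`). In a chart, 1 - t Dg is then
injective for 0 ≤ t ≤ 1, its determinant stays positive along the homotopy from 1, and the fixed
point contributes +1.

Components: cells are open, connected, and equal or disjoint. Permutations index the orders, and
reversal identifies them in pairs (`ncard_components`). -/

noncomputable section

/-! ## The index of a unique nondegenerate fixed point -/

/-- If no endomorphism `1 - t L` with `0 ≤ t ≤ 1` has a kernel, then `det (1 - L) > 0`. -/
theorem det_id_sub_pos_of_forall_injective {E : Type*} [NormedAddCommGroup E] [NormedSpace ℝ E]
    [FiniteDimensional ℝ E] (L : E →L[ℝ] E)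
    (h : ∀ t : ℝ, 0 ≤ t → t ≤ 1 → ∀ u, u = t • L u → u = 0) :
    0 < (ContinuousLinearMap.id ℝ E - L).det := by
  -- Homotopy from the identity: `d` is continuous, equals 1 at 0 and never vanishes on [0, 1], so
  -- it cannot change sign.
  let d : ℝ → ℝ := fun t => (ContinuousLinearMap.id ℝ E - t • L).det
  have hd : Continuous d := by
    refine ContinuousLinearMap.continuous_det.comp ?_
    fun_prop
  have hne : ∀ t ∈ Set.Icc (0 : ℝ) 1, d t ≠ 0 := by
    intro t ht h0
    have hker := LinearMap.bot_lt_ker_of_det_eq_zero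
      (f := ((ContinuousLinearMap.id ℝ E - t • L : E →L[ℝ] E) : E →ₗ[ℝ] E)) h0
    obtain ⟨u, hu, hu0⟩ := (Submodule.ne_bot_iff _).1 hker.ne'
    refine hu0 (h t ht.1 ht.2 u ?_)
    have : u - t • L u = 0 := hu
    exact sub_eq_zero.1 this
  have h0 : d 0 = 1 := by
    have : (ContinuousLinearMap.id ℝ E - (0 : ℝ) • L) = ContinuousLinearMap.id ℝ E := by simp
    simp only [d, this]
    exact LinearMap.det_id
  have h1 : d 1 = (ContinuousLinearMap.id ℝ E - L).det := by simp [d]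
  rw [← h1]
  by_contra hcon
  obtain ⟨t, ht, ht0⟩ := intermediate_value_Icc' zero_le_one hd.continuousOn
    (show (0 : ℝ) ∈ Set.Icc (d 1) (d 0) from ⟨not_lt.1 hcon, by rw [h0]; exact zero_le_one⟩)
  exact hne t ht ht0

/-- A unique fixed point `x₀` with `det (1 - Dg(x₀)) > 0` gives index `1`. -/
theorem HasFixedPointIndexOn.of_unique_fixedPoint {E : Type*} [NormedAddCommGroup E]
    [NormedSpace ℝ E] [FiniteDimensional ℝ E] {g : E → E} {U : Set E} (hU : IsOpen U)
    (hg : ContDiffOn ℝ 1 g U) {x₀ : E} (hfix : {x | x ∈ U ∧ g x = x} = {x₀})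
    (hdet : 0 < (ContinuousLinearMap.id ℝ E - fderiv ℝ g x₀).det) :
    HasFixedPointIndexOn g U 1 := by
  refine ⟨hU, hg, by rw [hfix]; exact isCompact_singleton, ?_⟩
  intro K hK hKU hFK
  have : CompleteSpace E := FiniteDimensional.complete ℝ E
  have hx₀ : x₀ ∈ U ∧ g x₀ = x₀ := by
    have : x₀ ∈ {x | x ∈ U ∧ g x = x} := by rw [hfix]; rfl
    exact this
  have hx₀K : x₀ ∈ interior K := hFK hx₀
  let h : E → E := fun x => x - g x
  have hstrict : HasStrictFDerivAt h (ContinuousLinearMap.id ℝ E - fderiv ℝ g x₀) x₀ :=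
    (hasStrictFDerivAt_id x₀).sub
      ((hg.contDiffAt (hU.mem_nhds hx₀.1)).hasStrictFDerivAt one_ne_zero)
  let e' := (ContinuousLinearMap.id ℝ E - fderiv ℝ g x₀).toContinuousLinearEquivOfDetNeZero
    hdet.ne'
  have hstrict' : HasStrictFDerivAt h (e' : E →L[ℝ] E) x₀ := by
    have : (e' : E →L[ℝ] E) = ContinuousLinearMap.id ℝ E - fderiv ℝ g x₀ :=
      ContinuousLinearMap.coe_toContinuousLinearEquivOfDetNeZero _ _
    rw [this]; exact hstrict
  let e := hstrict'.toOpenPartialHomeomorph h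
  have he : ∀ x, e x = h x := fun x => rfl
  have hx₀e : x₀ ∈ e.source := hstrict'.mem_toOpenPartialHomeomorph_source
  have hdetcont : ContinuousAt (fun x => (ContinuousLinearMap.id ℝ E - fderiv ℝ g x).det) x₀ := by
    have h1 : ContinuousAt (fderiv ℝ g) x₀ :=
      (hg.continuousOn_fderiv_of_isOpen hU le_rfl).continuousAt (hU.mem_nhds hx₀.1)
    exact ContinuousLinearMap.continuous_det.continuousAt.comp (continuousAt_const.sub h1)
  have hev : ∀ᶠ x in nhds x₀, x ∈ e.source ∧ x ∈ interior K ∧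
      0 < (ContinuousLinearMap.id ℝ E - fderiv ℝ g x).det :=
    (e.open_source.eventually_mem hx₀e).and ((isOpen_interior.eventually_mem hx₀K).and
      (hdetcont.eventually (lt_mem_nhds hdet)))
  -- On `N` the map `h` is injective and its Jacobian is positive; on the compact set `K \ N` it
  -- stays away from 0. So for y near 0 the equation `h x = y` has exactly one solution in `K`, it
  -- lies in `N`, and it counts +1.
  obtain ⟨N, hN, hNo, hx₀N⟩ := eventually_nhds_iff.1 hev
  have hh0 : h x₀ = 0 := by simp [h, hx₀.2]
  have hNimg : h '' N ∈ nhds (0 : E) := by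
    have : IsOpen (e '' N) := e.isOpen_image_of_subset_source hNo (fun x hx => (hN x hx).1)
    exact this.mem_nhds ⟨x₀, hx₀N, by rw [he, hh0]⟩
  have hcomp : IsCompact (h '' (K \ N)) :=
    (hK.diff hNo).image_of_continuousOn
      ((continuousOn_id.sub hg.continuousOn).mono (Set.sdiff_subset.trans hKU))
  have h0n : (0 : E) ∉ h '' (K \ N) := by
    rintro ⟨x, hx, hx0⟩
    have : x ∈ {x | x ∈ U ∧ g x = x} := ⟨hKU hx.1, (sub_eq_zero.1 hx0).symm⟩
    rw [hfix] at this
    exact hx.2 (this ▸ hx₀N)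
  filter_upwards [hNimg, hcomp.isClosed.isOpen_compl.mem_nhds h0n] with y hy1 hy2 _
  obtain ⟨x, hxN, hxy⟩ := hy1
  have hset : {x | x ∈ K ∧ x - g x = y} = {x} := by
    ext x'
    constructor
    · rintro ⟨hx'K, hx'y⟩
      have hx'N : x' ∈ N := by
        by_contra hcon
        exact hy2 ⟨x', ⟨hx'K, hcon⟩, hx'y⟩
      exact e.injOn (hN x' hx'N).1 (hN x hxN).1 (by rw [he, he]; exact hx'y.trans hxy.symm)
    · rintro rfl
      exact ⟨interior_subset (hN _ hxN).2.1, hxy⟩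
  refine (finsum_mem_congr hset fun _ _ => rfl).trans ?_
  rw [finsum_mem_singleton, sign_pos (hN x hxN).2.2]
  rfl

/-! ## Self-maps in affine charts -/

theorem Projectivization.continuous_mk' {K V : Type*} [DivisionRing K] [AddCommGroup V]
    [Module K V] [TopologicalSpace V] : Continuous (Projectivization.mk' K (V := V)) :=
  continuous_coinduced_rng

theorem Projectivization.isOpen_iff {K V : Type*} [DivisionRing K] [AddCommGroup V]
    [Module K V] [TopologicalSpace V] {s : Set (ℙ K V)} :
    IsOpen s ↔ IsOpen (Projectivization.mk' K ⁻¹' s) :=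
  isOpen_coinduced

/-- A map of projective space induced by a continuous map of vectors is continuous. -/
theorem Projectivization.continuousOn_of_lift {W : Type*} [NormedAddCommGroup W]
    [NormedSpace ℝ W] {f : ℙ ℝ W → ℙ ℝ W} {V : Set (ℙ ℝ W)} {F : W → W} (hV : IsOpen V)
    (hF : ∀ w (hw : w ≠ 0), Projectivization.mk ℝ w hw ∈ V → ContinuousAt F w ∧
      ∃ h : F w ≠ 0, f (Projectivization.mk ℝ w hw) = Projectivization.mk ℝ (F w) h) :
    ContinuousOn f V := by
  refine (continuousOn_open_iff hV).2 fun t ht => Projectivization.isOpen_iff.2 ?_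
  -- Openness is tested on nonzero vectors. As `F` takes values in `W`, the cone over `t` is first
  -- viewed as an open subset of `W`.
  have h1 : IsOpen (Subtype.val '' (Projectivization.mk' ℝ (V := W) ⁻¹' t)) :=
    isOpen_ne.isOpenMap_subtype_val _ (Projectivization.isOpen_iff.1 ht)
  have h2 : Projectivization.mk' ℝ (V := W) ⁻¹' (V ∩ f ⁻¹' t) =
      Projectivization.mk' ℝ ⁻¹' V ∩
        (fun w : {w : W // w ≠ 0} => F w) ⁻¹' (Subtype.val '' (Projectivization.mk' ℝ ⁻¹' t)) := by
    ext w
    refine and_congr_right fun hw => ?_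
    obtain ⟨-, h, hfw⟩ := hF w.1 w.2 hw
    rw [Set.mem_preimage, Projectivization.mk'_eq_mk, hfw]
    constructor
    · exact fun h' => ⟨⟨F w, h⟩, h', rfl⟩
    · rintro ⟨w', h', hw'⟩
      have : w' = ⟨F w, h⟩ := Subtype.ext hw'
      rwa [this] at h'
  rw [h2]
  refine ContinuousOn.isOpen_inter_preimage (fun w hw => ?_) (Projectivization.isOpen_iff.1 hV) h1
  exact ((hF w.1 w.2 hw).1.comp continuousAt_subtype_val).continuousWithinAt

namespace AffineChart

variable {W : Type*} [NormedAddCommGroup W] [NormedSpace ℝ W] (c : AffineChart W)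

/-- The projection of the ambient space to the model space along the origin of the chart. -/
def proj : W →ₗ[ℝ] c.Model :=
  LinearMap.codRestrict (LinearMap.ker c.form) (LinearMap.id - c.form.smulRight c.base)
    (by intro w; simp [LinearMap.mem_ker, c.form_base])

theorem coe_proj (w : W) : (c.proj w : W) = w - c.form w • c.base := rfl

theorem coord_mk_eq_proj {w : W} (hw : w ≠ 0) (h : c.form w ≠ 0) :
    c.coord (Projectivization.mk ℝ w hw) = c.proj ((c.form w)⁻¹ • w) := by
  apply Subtype.ext
  rw [c.coord_mk hw h, coe_proj, map_smul, smul_eq_mul, inv_mul_cancel₀ h, one_smul]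

/-- In an affine chart, the fixed point index is `1` for a self-map `f` that is induced by a map `F`
of vectors and has only one fixed point `[w]`, provided that the derivative of `F` at `w` has no
eigenvalue in `[l, ∞)` modulo the line of `w`, where `F w = l • w`. -/
theorem hasFixedPointIndexOn_one [FiniteDimensional ℝ W] {f : ℙ ℝ W → ℙ ℝ W} {V : Set (ℙ ℝ W)} {F : W → W}
    (hV : IsOpen V)
    (hF : ∀ w (hw : w ≠ 0), Projectivization.mk ℝ w hw ∈ V → ContDiffAt ℝ 1 F w ∧
      ∃ h : F w ≠ 0, f (Projectivization.mk ℝ w hw) = Projectivization.mk ℝ (F w) h)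
    {p : ℙ ℝ W} (hfix : {q | q ∈ V ∧ f q = q} = {p}) (hp : p ∈ c.domain)
    (hnd : ∀ (w : W) (hw : w ≠ 0), Projectivization.mk ℝ w hw = p → ∀ l : ℝ, F w = l • w →
      ∀ s : ℝ, 0 ≤ s → ∀ (u : W) (a : ℝ), u = s • (l⁻¹ • fderiv ℝ F w u) + a • w →
        ∃ b : ℝ, u = b • w) :
    HasFixedPointIndexOn (fun v : c.Model => c.coord (f (c.point v)))
      {v | c.point v ∈ V ∧ f (c.point v) ∈ c.domain} 1 := by
  have hform : Continuous c.form := c.form.continuous_of_finiteDimensional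
  have hpointc : Continuous c.point :=
    Projectivization.continuous_mk'.comp (f := fun v : c.Model =>
      (⟨c.base + (v : W), c.base_add_ne_zero v⟩ : {w : W // w ≠ 0})) (by fun_prop)
  have hmem : ∀ v : c.Model, c.point v ∈ V →
      (f (c.point v) ∈ c.domain ↔ c.form (F (c.base + (v : W))) ≠ 0) := by
    intro v hv
    obtain ⟨-, h, hfe⟩ := hF _ (c.base_add_ne_zero v) hv
    rw [point, hfe, mk_mem_domain]
  have hFc : ∀ v : c.Model, c.point v ∈ V →
      ContDiffAt ℝ 1 (fun v : c.Model => F (c.base + (v : W))) v := by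
    intro v hv
    have h1 : ContDiffAt ℝ 1 (fun v : c.Model => c.base + (v : W)) v :=
      contDiffAt_const.add (Submodule.subtypeL (LinearMap.ker c.form)).contDiff.contDiffAt
    exact ContDiffAt.comp (f := fun v : c.Model => c.base + (v : W)) (g := F) v
      (hF _ (c.base_add_ne_zero v) hv).1 h1
  have hVo : IsOpen {v : c.Model | c.point v ∈ V} := hV.preimage hpointc
  have hUeq : {v : c.Model | c.point v ∈ V ∧ f (c.point v) ∈ c.domain} =
      {v | c.point v ∈ V} ∩ (fun v : c.Model => c.form (F (c.base + (v : W)))) ⁻¹' {0}ᶜ := by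
    ext v
    exact and_congr_right fun hv => hmem v hv
  have hUo : IsOpen {v : c.Model | c.point v ∈ V ∧ f (c.point v) ∈ c.domain} := by
    rw [hUeq]
    refine ContinuousOn.isOpen_inter_preimage (fun v hv => ?_) hVo isOpen_compl_singleton
    exact (hform.continuousAt.comp (hFc v hv).continuousAt).continuousWithinAt
  have hgeq : ∀ v : c.Model, v ∈ {v : c.Model | c.point v ∈ V ∧ f (c.point v) ∈ c.domain} →
      c.coord (f (c.point v)) =
        c.proj ((c.form (F (c.base + (v : W))))⁻¹ • F (c.base + (v : W))) := by
    intro v hv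
    have h2 := (hmem v hv.1).1 hv.2
    obtain ⟨-, h, hfe⟩ := hF _ (c.base_add_ne_zero v) hv.1
    rw [point, hfe, coord_mk_eq_proj _ _ h2]
  have hg : ContDiffOn ℝ 1 (fun v : c.Model => c.coord (f (c.point v)))
      {v | c.point v ∈ V ∧ f (c.point v) ∈ c.domain} := by
    refine ContDiffOn.congr (fun v hv => ContDiffAt.contDiffWithinAt ?_) hgeq
    have h1 : ContDiffAt ℝ 1 (fun v : c.Model => c.form (F (c.base + (v : W)))) v :=
      (LinearMap.toContinuousLinearMap c.form).contDiff.contDiffAt.comp v (hFc v hv.1)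
    exact (LinearMap.toContinuousLinearMap c.proj).contDiff.contDiffAt.comp v
      ((h1.inv ((hmem v hv.1).1 hv.2)).smul (hFc v hv.1))
  have hpV : p ∈ V ∧ f p = p := by
    have : p ∈ {q | q ∈ V ∧ f q = q} := by rw [hfix]; rfl
    exact this
  have hpt : c.point (c.coord p) = p := c.point_coord hp
  refine HasFixedPointIndexOn.of_unique_fixedPoint hUo hg (x₀ := c.coord p) ?_ ?_
  · ext v
    constructor
    · rintro ⟨⟨h1, h2⟩, h3⟩
      have h4 : c.point v ∈ {q | q ∈ V ∧ f q = q} := by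
        refine ⟨h1, ?_⟩
        rw [← c.point_coord h2]
        exact congrArg c.point h3
      rw [hfix] at h4
      rw [Set.mem_singleton_iff, ← show c.point v = p from h4, c.coord_point]
    · rintro rfl
      refine ⟨⟨?_, ?_⟩, ?_⟩
      · rw [hpt]; exact hpV.1
      · rw [hpt, hpV.2]; exact hp
      · show c.coord (f (c.point (c.coord p))) = c.coord p
        rw [hpt, hpV.2]
  · set v₀ := c.coord p with hv₀
    set x : W := c.base + (v₀ : W) with hx
    have hx0 : x ≠ 0 := c.base_add_ne_zero v₀
    have hxp : Projectivization.mk ℝ x hx0 = p := hpt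
    have hformx : c.form x = 1 := by
      rw [hx, map_add, c.form_base, LinearMap.mem_ker.1 v₀.2, add_zero]
    obtain ⟨hFx, hFx0, hfx⟩ := hF x hx0 (by rw [hxp]; exact hpV.1)
    obtain ⟨l, hl⟩ : ∃ l : ℝ, F x = l • x := by
      rw [hxp, hpV.2, ← hxp, Projectivization.mk_eq_mk_iff'] at hfx
      obtain ⟨a, ha⟩ := hfx
      refine ⟨a⁻¹, ?_⟩
      have ha0 : a ≠ 0 := by
        rintro rfl
        exact hx0 (by rw [← ha, zero_smul])
      rw [eq_inv_smul_iff₀ ha0, ha]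
    have hl0 : l ≠ 0 := by
      rintro rfl
      exact hFx0 (by rw [hl, zero_smul])
    have hv₀U : v₀ ∈ {v : c.Model | c.point v ∈ V ∧ f (c.point v) ∈ c.domain} := by
      refine ⟨?_, ?_⟩
      · rw [hpt]; exact hpV.1
      · rw [hpt, hpV.2]; exact hp
    set g : c.Model → c.Model := fun v => c.coord (f (c.point v)) with hgdef
    set A := fderiv ℝ F x with hA
    -- Quotient rule for F / form F at `x`, where form x = 1 and F x = l x: the chart derivative is
    -- l⁻¹ DF(x), corrected by the multiple of `x` that brings it back into the kernel of the form.
    have hder : ∀ u : c.Model,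
        ((fderiv ℝ g v₀ u : c.Model) : W) = l⁻¹ • A u - (l⁻¹ * c.form (A u)) • x := by
      intro u
      have h1 : HasFDerivAt (fun v : c.Model => c.base + (v : W))
          (Submodule.subtypeL (LinearMap.ker c.form)) v₀ :=
        (Submodule.subtypeL (LinearMap.ker c.form)).hasFDerivAt.const_add _
      have h2 : HasFDerivAt F A x := (hFx.differentiableAt one_ne_zero).hasFDerivAt
      have h3 : HasFDerivAt (fun v : c.Model => F (c.base + (v : W))) _ v₀ := h2.comp v₀ h1
      have h4 : HasFDerivAt (fun v : c.Model => c.form (F (c.base + (v : W)))) _ v₀ :=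
        (LinearMap.toContinuousLinearMap c.form).hasFDerivAt.comp v₀ h3
      have hlf : c.form (F (c.base + (v₀ : W))) = l := by
        rw [← hx, hl, map_smul, hformx, smul_eq_mul, mul_one]
      have h5 : HasFDerivAt (fun v : c.Model => (c.form (F (c.base + (v : W))))⁻¹) _ v₀ :=
        (hasDerivAt_inv (by rw [hlf]; exact hl0)).comp_hasFDerivAt v₀ h4
      have h6 : HasFDerivAt (fun v : c.Model => c.proj ((c.form (F (c.base + (v : W))))⁻¹ •
          F (c.base + (v : W)))) _ v₀ :=
        (LinearMap.toContinuousLinearMap c.proj).hasFDerivAt.comp v₀ (h5.smul h3)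
      have h7 : g =ᶠ[nhds v₀] fun v : c.Model => c.proj ((c.form (F (c.base + (v : W))))⁻¹ •
          F (c.base + (v : W))) :=
        Filter.eventually_of_mem (hUo.mem_nhds hv₀U) hgeq
      rw [(h6.congr_of_eventuallyEq h7).fderiv]
      simp only [← hx, hl, map_smul, hformx, smul_eq_mul, mul_one]
      simp [coe_proj, hformx]
      match_scalars <;> field_simp
      ring
    refine det_id_sub_pos_of_forall_injective _ fun t ht _ u hu => ?_
    have hu' : (u : W) = t • (l⁻¹ • A u) + (-(t * (l⁻¹ * c.form (A u)))) • x := by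
      have := congrArg (Subtype.val) hu
      rw [Submodule.coe_smul, hder] at this
      refine this.trans ?_
      module
    obtain ⟨b, hb⟩ := hnd x hx0 hxp l hl t ht u _ hu'
    -- The form vanishes on `u` and equals 1 on `x`, so a model vector on the line of `x` is zero.
    have hb0 : b = 0 := by
      have := LinearMap.mem_ker.1 u.2
      rw [hb, map_smul, hformx, smul_eq_mul, mul_one] at this
      exact this
    apply Subtype.ext
    rw [hb, hb0, zero_smul]; rfl

end AffineChart

/-! ## The power law -/

theorem hasDerivAt_abs_rpow_mul_self (α : ℝ) {t : ℝ} (ht : t ≠ 0) :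
    HasDerivAt (fun s : ℝ => |s| ^ α * s) ((α + 1) * |t| ^ α) t := by
  have h := ((hasDerivAt_abs ht).rpow_const (p := α) (Or.inl (abs_ne_zero.2 ht))).mul
    (hasDerivAt_id t)
  refine h.congr_deriv ?_
  have h1 : (SignType.sign t : ℝ) * t = |t| := sign_mul_self t
  have h2 : |t| ^ (α - 1) * |t| = |t| ^ α := by
    rw [Real.rpow_sub_one (abs_ne_zero.2 ht), div_mul_cancel₀ _ (abs_ne_zero.2 ht)]
  simp only [id, mul_one]
  linear_combination (α * |t| ^ (α - 1)) * h1 + α * h2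

/-- A primitive of `t ↦ -|t| ^ α t` with an affine lower bound in `|t|`. -/
theorem exists_primitive_neg_abs_rpow_mul_self {α : ℝ} (hα : α < -1) :
    ∃ Ψ : ℝ → ℝ, (∀ t ≠ 0, HasDerivAt Ψ (-(|t| ^ α * t)) t) ∧
      ∃ C D : ℝ, 0 ≤ D ∧ ∀ t ≠ 0, C - D * |t| ≤ Ψ t := by
  -- The primitive is -log |t| for α = -2 and -|t|^(α+2)/(α+2) otherwise. The latter is nonnegative
  -- if α + 2 < 0; if 0 < α + 2 < 1, the bound comes from |t|^(α+2) ≤ 1 + |t|.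
  by_cases h2 : α = -2
  · refine ⟨fun t => -Real.log t, fun t ht => ?_, 1, 1, zero_le_one, fun t ht => ?_⟩
    · refine (Real.hasDerivAt_log ht).neg.congr_deriv ?_
      rw [h2, Real.rpow_neg (abs_nonneg t), Real.rpow_two, sq_abs]
      field_simp
    · have h := Real.log_le_sub_one_of_pos (abs_pos.2 ht)
      rw [Real.log_abs] at h
      linarith
  · have hp : α + 2 ≠ 0 := fun h => h2 (by linarith)
    refine ⟨fun t => -(|t| ^ (α + 2) / (α + 2)), fun t ht => ?_, ?_⟩
    · have h := (((hasDerivAt_abs ht).rpow_const (p := α + 2)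
        (Or.inl (abs_ne_zero.2 ht))).div_const (α + 2)).neg
      refine h.congr_deriv ?_
      have h3 : |t| ^ (α + 2 - 1) = |t| ^ α * |t| := by
        rw [show α + 2 - 1 = α + 1 by ring, Real.rpow_add_one (abs_ne_zero.2 ht)]
      have h4 : (SignType.sign t : ℝ) * |t| = t := sign_mul_abs t
      rw [h3, show (SignType.sign t : ℝ) * (α + 2) * (|t| ^ α * |t|) / (α + 2) =
        |t| ^ α * ((SignType.sign t : ℝ) * |t|) by field_simp, h4]
    · rcases lt_or_gt_of_ne hp with hneg | hpos
      · refine ⟨0, 0, le_rfl, fun t ht => ?_⟩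
        have : |t| ^ (α + 2) / (α + 2) ≤ 0 :=
          div_nonpos_of_nonneg_of_nonpos (by positivity) hneg.le
        linarith
      · refine ⟨-(1 / (α + 2)), 1 / (α + 2), by positivity, fun t ht => ?_⟩
        have h : |t| ^ (α + 2) ≤ 1 + |t| := by
          rcases le_total |t| 1 with h1 | h1
          · have := Real.rpow_le_one (abs_nonneg t) h1 hpos.le
            linarith [abs_nonneg t]
          · have := Real.rpow_le_rpow_of_exponent_le h1 (show α + 2 ≤ 1 by linarith)
            rw [Real.rpow_one] at this
            linarith
        have h5 : |t| ^ (α + 2) / (α + 2) ≤ (1 + |t|) / (α + 2) := by gcongr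
        have h6 : (1 + |t|) / (α + 2) = 1 / (α + 2) + 1 / (α + 2) * |t| := by ring
        linarith

/-- For numbers of the same sign, `t ↦ |t| ^ α t` with `α < -1` is decreasing. -/
theorem abs_rpow_mul_self_sub_mul_nonpos {α : ℝ} (hα : α < -1) {s t : ℝ} (hst : 0 < s * t) :
    (|s| ^ α * s - |t| ^ α * t) * (s - t) ≤ 0 := by
  have key : ∀ a b : ℝ, 0 < a → 0 < b → (|a| ^ α * a - |b| ^ α * b) * (a - b) ≤ 0 := by
    intro a b ha hb
    rw [abs_of_pos ha, abs_of_pos hb, ← Real.rpow_add_one ha.ne', ← Real.rpow_add_one hb.ne']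
    rcases le_total a b with h | h
    · have := Real.rpow_le_rpow_of_nonpos ha h (show α + 1 ≤ 0 by linarith)
      exact mul_nonpos_of_nonneg_of_nonpos (by linarith) (by linarith)
    · have := Real.rpow_le_rpow_of_nonpos hb h (show α + 1 ≤ 0 by linarith)
      exact mul_nonpos_of_nonpos_of_nonneg (by linarith) (by linarith)
  rcases pos_and_pos_or_neg_and_neg_of_mul_pos hst with ⟨hs, ht⟩ | ⟨hs, ht⟩
  · exact key s t hs ht
  · have := key (-s) (-t) (neg_pos.2 hs) (neg_pos.2 ht)
    rw [abs_neg, abs_neg] at this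
    linarith

/-! ### Vectors with a common order, and the pairing of the force with a vector. -/

namespace BodySystem

variable {n : ℕ} (S : BodySystem n)

theorem coeff_pos_of_ne (hpos : ∀ i j, i < j → 0 < S.coeff i j) {i j : Fin n} (hij : i ≠ j) :
    0 < S.coeff i j :=
  (lt_or_gt_of_ne hij).elim (hpos i j) fun h => S.coeff_symm i j ▸ hpos j i h

/-- The vectors `z` and `z₀` have distinct coordinates, in the same order. -/
def SameOrder (z₀ z : Fin n → ℝ) : Prop := ∀ i j, i ≠ j → 0 < (z i - z j) * (z₀ i - z₀ j)

theorem SameOrder.ne {z₀ z : Fin n → ℝ} (h : SameOrder z₀ z) {i j : Fin n} (hij : i ≠ j) :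
    z i ≠ z j := by
  intro h0
  have := h i j hij
  rw [h0, sub_self, zero_mul] at this
  exact this.false

theorem SameOrder.refl {z : Fin n → ℝ} (hz : ∀ i j, i ≠ j → z i ≠ z j) : SameOrder z z :=
  fun i j hij => mul_self_pos.2 (sub_ne_zero.2 (hz i j hij))

theorem SameOrder.symm {z₀ z : Fin n → ℝ} (h : SameOrder z₀ z) : SameOrder z z₀ :=
  fun i j hij => mul_comm (z i - z j) _ ▸ h i j hij

theorem SameOrder.trans {x y z : Fin n → ℝ} (h : SameOrder x y) (h' : SameOrder y z) :
    SameOrder x z := by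
  intro i j hij
  -- The product of the two inequalities contains the square of the `y` difference, which is
  -- positive and can be divided out.
  have h1 := mul_pos (h i j hij) (h' i j hij)
  have h2 : 0 < (y i - y j) * (y i - y j) := mul_self_pos.2 (sub_ne_zero.2 (h.ne hij))
  by_contra hcon
  have := mul_nonneg h2.le (neg_nonneg.2 (not_lt.1 hcon))
  nlinarith

theorem SameOrder.smul {z₀ z : Fin n → ℝ} (h : SameOrder z₀ z) {a : ℝ} (ha : 0 < a) :
    SameOrder z₀ (a • z) := by
  intro i j hij
  have := mul_pos ha (h i j hij)
  simp only [Pi.smul_apply, smul_eq_mul]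
  linarith

theorem SameOrder.neg_neg {z₀ z : Fin n → ℝ} (h : SameOrder z₀ z) : SameOrder (-z₀) (-z) := by
  intro i j hij
  have := h i j hij
  simp only [Pi.neg_apply]
  linarith

theorem forceVec_real (z : Fin n → ℝ) (i : Fin n) : S.forceVec z i =
    ∑ j ∈ Finset.univ.erase i,
      ((S.mass i)⁻¹ * S.coeff i j * |z i - z j| ^ S.α) * (z i - z j) := by
  simp [forceVec]

/-- Exchanging i and j in the double sum and averaging turns v i into half of v i - v j, since the
pair force is antisymmetric. This weak form gives all the sign arguments about the force below. -/
theorem sum_mass_mul_forceVec_mul (z v : Fin n → ℝ) :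
    ∑ i, S.mass i * S.forceVec z i * v i = 1 / 2 * ∑ i, ∑ j ∈ Finset.univ.erase i,
      S.coeff i j * (|z i - z j| ^ S.α * (z i - z j) * (v i - v j)) := by
  have h1 : ∀ i, S.mass i * S.forceVec z i * v i =
      ∑ j, S.coeff i j * (|z i - z j| ^ S.α * (z i - z j)) * v i := by
    intro i
    have hm : S.mass i ≠ 0 := (S.mass_pos i).ne'
    rw [forceVec_real, Finset.sum_erase _ (by rw [sub_self, mul_zero]), Finset.mul_sum,
      Finset.sum_mul]
    refine Finset.sum_congr rfl fun j _ => ?_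
    field_simp
  have h2 : ∑ i, ∑ j, S.coeff i j * (|z i - z j| ^ S.α * (z i - z j)) * v i =
      ∑ i, ∑ j, -(S.coeff i j * (|z i - z j| ^ S.α * (z i - z j)) * v j) := by
    rw [Finset.sum_comm]
    refine Finset.sum_congr rfl fun i _ => Finset.sum_congr rfl fun j _ => ?_
    rw [S.coeff_symm j i, abs_sub_comm (z j) (z i)]
    ring
  have h3 : ∀ i, ∑ j ∈ Finset.univ.erase i,
      S.coeff i j * (|z i - z j| ^ S.α * (z i - z j) * (v i - v j)) =
      ∑ j, S.coeff i j * (|z i - z j| ^ S.α * (z i - z j)) * v i +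
      ∑ j, -(S.coeff i j * (|z i - z j| ^ S.α * (z i - z j)) * v j) := by
    intro i
    rw [Finset.sum_erase _ (by rw [sub_self, mul_zero, zero_mul, mul_zero]),
      ← Finset.sum_add_distrib]
    exact Finset.sum_congr rfl fun j _ => by ring
  simp only [h1, h3, Finset.sum_add_distrib]
  rw [← h2]
  ring

/-! ## Existence and uniqueness of the normalized central configuration -/

/-- Pair F(z) - F(z') = z - z' with z - z'. The left side is a sum of nonpositive terms because the
pair force decreases on each half-line; the right side is the squared mass norm. -/
theorem eq_of_forceVec_eq_self (hpos : ∀ i j, i < j → 0 < S.coeff i j) (hα : S.α < -1)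
    {z z' : Fin n → ℝ} (h : SameOrder z z') (hz : S.forceVec z = z) (hz' : S.forceVec z' = z') :
    z = z' := by
  have h1 : ∑ i, S.mass i * ((z i - z' i) * (z i - z' i)) = 1 / 2 * ∑ i,
      ∑ j ∈ Finset.univ.erase i, S.coeff i j * ((|z i - z j| ^ S.α * (z i - z j) -
        |z' i - z' j| ^ S.α * (z' i - z' j)) * ((z i - z j) - (z' i - z' j))) := by
    have h2 := S.sum_mass_mul_forceVec_mul z (z - z')
    have h3 := S.sum_mass_mul_forceVec_mul z' (z - z')
    rw [hz] at h2
    rw [hz'] at h3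
    have h4 := congrArg₂ (· - ·) h2 h3
    simp only [← mul_sub, ← Finset.sum_sub_distrib] at h4
    refine Eq.trans ?_ (h4.trans ?_)
    · refine Finset.sum_congr rfl fun i _ => ?_
      simp only [Pi.sub_apply]; ring
    · congr 1
      refine Finset.sum_congr rfl fun i _ => Finset.sum_congr rfl fun j _ => ?_
      simp only [Pi.sub_apply]; ring
  have h5 : ∑ i, S.mass i * ((z i - z' i) * (z i - z' i)) ≤ 0 := by
    rw [h1]
    refine mul_nonpos_of_nonneg_of_nonpos (by norm_num) (Finset.sum_nonpos fun i _ =>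
      Finset.sum_nonpos fun j hj => mul_nonpos_of_nonneg_of_nonpos ?_ ?_)
    · exact (S.coeff_pos_of_ne hpos (Finset.ne_of_mem_erase hj).symm).le
    · refine abs_rpow_mul_self_sub_mul_nonpos hα ?_
      rw [mul_comm]
      exact h i j (Finset.ne_of_mem_erase hj).symm
  have h6 : ∀ i ∈ Finset.univ, 0 ≤ S.mass i * ((z i - z' i) * (z i - z' i)) := fun i _ =>
    mul_nonneg (S.mass_pos i).le (mul_self_nonneg _)
  have h7 := (Finset.sum_eq_zero_iff_of_nonneg h6).1 (le_antisymm h5 (Finset.sum_nonneg h6))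
  funext i
  have h8 := (mul_eq_zero.1 (h7 i (Finset.mem_univ i))).resolve_left (S.mass_pos i).ne'
  exact sub_eq_zero.1 (mul_self_eq_zero.1 h8)

/-- The function whose critical points in a cone of vectors with a given order are the normalized
central configurations. -/
def potential (Ψ : ℝ → ℝ) (z : Fin n → ℝ) : ℝ :=
  1 / 2 * ∑ i, S.mass i * z i ^ 2 +
    1 / 2 * ∑ i, ∑ j ∈ Finset.univ.erase i, S.coeff i j * Ψ (z i - z j)

/-- By the weak form of the force, the mass-weighted gradient of the potential is z - F(z). -/
theorem hasDerivAt_potential {Ψ : ℝ → ℝ} (hΨ : ∀ t ≠ 0, HasDerivAt Ψ (-(|t| ^ S.α * t)) t)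
    {z : Fin n → ℝ} (hz : ∀ i j, i ≠ j → z i ≠ z j) (v : Fin n → ℝ) :
    HasDerivAt (fun t : ℝ => S.potential Ψ (z + t • v))
      (∑ i, S.mass i * (z i - S.forceVec z i) * v i) 0 := by
  have hlin : ∀ i, HasDerivAt (fun t : ℝ => (z + t • v) i) (v i) 0 := by
    intro i
    simpa using ((hasDerivAt_id (0 : ℝ)).mul_const (v i)).const_add (z i)
  have h1 : HasDerivAt (fun t : ℝ => ∑ i, S.mass i * (z + t • v) i ^ 2)
      (∑ i, S.mass i * (2 * z i * v i)) 0 := by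
    refine HasDerivAt.fun_sum fun i _ => ?_
    refine (((hlin i).pow 2).const_mul _).congr_deriv ?_
    simp
  have h2 : HasDerivAt (fun t : ℝ => ∑ i, ∑ j ∈ Finset.univ.erase i,
      S.coeff i j * Ψ ((z + t • v) i - (z + t • v) j))
      (∑ i, ∑ j ∈ Finset.univ.erase i,
        S.coeff i j * (-(|z i - z j| ^ S.α * (z i - z j)) * (v i - v j))) 0 := by
    refine HasDerivAt.fun_sum fun i _ => HasDerivAt.fun_sum fun j hj => HasDerivAt.const_mul _ ?_
    have h3 := hΨ (z i - z j) (sub_ne_zero.2 (hz i j (Finset.ne_of_mem_erase hj).symm))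
    have h4 : HasDerivAt (fun t : ℝ => (z + t • v) i - (z + t • v) j) (v i - v j) 0 :=
      (hlin i).sub (hlin j)
    exact HasDerivAt.comp (h₂ := Ψ) (0 : ℝ) (by simpa using h3) h4
  refine ((h1.const_mul (1 / 2)).add (h2.const_mul (1 / 2))).congr_deriv ?_
  have h5 := S.sum_mass_mul_forceVec_mul z v
  simp only [mul_sub, sub_mul, Finset.sum_sub_distrib, neg_mul, mul_neg, Finset.sum_neg_distrib] at *
  rw [h5, Finset.mul_sum (a := (1 / 2 : ℝ))]
  have h6 : ∀ i, 1 / 2 * (S.mass i * (2 * z i * v i)) = S.mass i * z i * v i := fun i => by ring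
  simp only [h6]
  ring

/-- The potential is coercive: its quadratic part dominates the at most linear decrease allowed by
the lower bound on `Ψ`. -/
theorem exists_bound_of_potential_le [Nonempty (Fin n)]
    (hpos : ∀ i j, i < j → 0 < S.coeff i j) {Ψ : ℝ → ℝ} {C D : ℝ} (hD : 0 ≤ D)
    (hΨ : ∀ t ≠ 0, C - D * |t| ≤ Ψ t) (G₀ : ℝ) :
    ∃ R : ℝ, ∀ z : Fin n → ℝ, (∀ i j, i ≠ j → z i ≠ z j) → S.potential Ψ z ≤ G₀ → ‖z‖ ≤ R := by
  obtain ⟨k, -, hk⟩ := Finset.exists_min_image Finset.univ S.mass Finset.univ_nonempty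
  set m := S.mass k with hm
  have hm0 : 0 < m := S.mass_pos k
  set A : ℝ := ∑ i, ∑ j ∈ Finset.univ.erase i, S.coeff i j with hA
  have hA0 : 0 ≤ A := Finset.sum_nonneg fun i _ => Finset.sum_nonneg fun j hj =>
    (S.coeff_pos_of_ne hpos (Finset.ne_of_mem_erase hj).symm).le
  set B : ℝ := |G₀| + |A * C| with hB
  -- A sublevel vector satisfies m‖z‖² ≤ 2AD‖z‖ + 2B. The summand 1 gives ‖z‖ > 1 in the contrary
  -- case, so that 2B ≤ 2B‖z‖ and one factor ‖z‖ can be cancelled.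
  refine ⟨1 + (2 * (A * D) + 2 * B) / m, fun z hz hG => ?_⟩
  by_contra hcon
  rw [not_le] at hcon
  have hB0 : 0 ≤ B := by positivity
  have hR1 : 1 < ‖z‖ := lt_of_le_of_lt (le_add_of_nonneg_right (by positivity)) hcon
  have hR2 : 2 * (A * D) + 2 * B < m * ‖z‖ := by
    have : (2 * (A * D) + 2 * B) / m < ‖z‖ := by linarith
    rwa [div_lt_iff₀' hm0] at this
  have h1 : m * ‖z‖ ^ 2 ≤ ∑ i, S.mass i * z i ^ 2 := by
    obtain ⟨i, -, hi⟩ := Finset.exists_max_image Finset.univ (fun i => ‖z i‖) Finset.univ_nonempty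
    have hzi : ‖z‖ ≤ ‖z i‖ := (pi_norm_le_iff_of_nonneg (norm_nonneg _)).2 fun j =>
      hi j (Finset.mem_univ j)
    calc m * ‖z‖ ^ 2 ≤ S.mass i * ‖z i‖ ^ 2 := by
          exact mul_le_mul (hk i (Finset.mem_univ i)) (pow_le_pow_left₀ (norm_nonneg _) hzi 2)
            (sq_nonneg _) (S.mass_pos i).le
      _ = S.mass i * z i ^ 2 := by rw [Real.norm_eq_abs, sq_abs]
      _ ≤ _ := Finset.single_le_sum (f := fun i => S.mass i * z i ^ 2)
          (fun j _ => mul_nonneg (S.mass_pos j).le (sq_nonneg _)) (Finset.mem_univ i)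
  have h2 : A * (C - D * (2 * ‖z‖)) ≤
      ∑ i, ∑ j ∈ Finset.univ.erase i, S.coeff i j * Ψ (z i - z j) := by
    rw [hA, Finset.sum_mul]
    refine Finset.sum_le_sum fun i _ => ?_
    rw [Finset.sum_mul]
    refine Finset.sum_le_sum fun j hj => ?_
    have hij := (Finset.ne_of_mem_erase hj).symm
    refine mul_le_mul_of_nonneg_left ?_ (S.coeff_pos_of_ne hpos hij).le
    refine le_trans ?_ (hΨ _ (sub_ne_zero.2 (hz i j hij)))
    have h3 : |z i - z j| ≤ 2 * ‖z‖ := by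
      have h4 := norm_le_pi_norm z i
      have h5 := norm_le_pi_norm z j
      have h6 := norm_sub_le (z i) (z j)
      rw [Real.norm_eq_abs (z i - z j)] at h6
      linarith
    have := mul_le_mul_of_nonneg_left h3 hD
    linarith
  have h3 : S.potential Ψ z = 1 / 2 * ∑ i, S.mass i * z i ^ 2 +
    1 / 2 * ∑ i, ∑ j ∈ Finset.univ.erase i, S.coeff i j * Ψ (z i - z j) := rfl
  have h4 := neg_abs_le (A * C)
  have h5 := le_abs_self G₀
  have h6 : 0 ≤ |A * C| := abs_nonneg _
  have h7 : 0 ≤ |G₀| := abs_nonneg _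
  have h8 : 0 ≤ A * D := mul_nonneg hA0 hD
  have h9 : ‖z‖ * (2 * B) ≤ ‖z‖ * (m * ‖z‖ - 2 * (A * D)) :=
    mul_le_mul_of_nonneg_left (by linarith) (norm_nonneg _)
  have h10 : 2 * B ≤ ‖z‖ * (2 * B) := le_mul_of_one_le_left (by linarith) hR1.le
  have h11 : 2 * B < ‖z‖ * (m * ‖z‖ - 2 * (A * D)) :=
    lt_of_le_of_lt h10 (mul_lt_mul_of_pos_left (by linarith) (by linarith))
  nlinarith

/-- If the potential does not decrease in the direction z₀, then ∑ m F(z) z₀ ≤ ∑ m z z₀ ≤ Q. By the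
weak form, the left side is half a sum of nonnegative pair terms, so each term is at most 2Q. The
term of (i, j) contains |zᵢ - zⱼ|^(α+1), which tends to infinity at a collision, so the gap is
bounded below. -/
theorem eventually_lt_gap (hpos : ∀ i j, i < j → 0 < S.coeff i j) (hα : S.α < -1)
    {z₀ : Fin n → ℝ} (h₀ : ∀ i j, i ≠ j → z₀ i ≠ z₀ j) (R : ℝ) {i j : Fin n} (hij : i ≠ j) :
    ∀ᶠ δ in nhdsWithin (0 : ℝ) (Set.Ioi 0), ∀ z, SameOrder z₀ z → ‖z‖ ≤ R →
      0 ≤ ∑ k, S.mass k * (z k - S.forceVec z k) * z₀ k →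
      δ < (z i - z j) * (z₀ i - z₀ j) := by
  set Q : ℝ := ∑ k, S.mass k * (R * |z₀ k|) with hQ
  have hd : 0 < |z₀ i - z₀ j| := abs_pos.2 (sub_ne_zero.2 (h₀ i j hij))
  have hc := S.coeff_pos_of_ne hpos hij
  have ht := (tendsto_rpow_neg_nhdsGT_zero (show S.α + 1 < 0 by linarith)).eventually
    (Filter.eventually_gt_atTop (2 * Q / (S.coeff i j * |z₀ i - z₀ j|)))
  obtain ⟨ε, hε, hε'⟩ := mem_nhdsGT_iff_exists_Ioo_subset.1 ht
  have hε0 : 0 < ε := hε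
  filter_upwards [Ioo_mem_nhdsGT (mul_pos hε0 hd)] with δ hδ z hz hzR hz0
  have hzd : 0 < |z i - z j| := abs_pos.2 (sub_ne_zero.2 (hz.ne hij))
  have hp : (z i - z j) * (z₀ i - z₀ j) = |z i - z j| * |z₀ i - z₀ j| := by
    rw [← abs_mul, abs_of_pos (hz i j hij)]
  have h1 : ∑ k, S.mass k * z k * z₀ k ≤ Q := by
    refine Finset.sum_le_sum fun k _ => ?_
    have h2 : |z k| ≤ R := (norm_le_pi_norm z k).trans hzR
    have h3 : z k * z₀ k ≤ R * |z₀ k| := (le_abs_self _).trans (by rw [abs_mul]; gcongr)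
    have := mul_le_mul_of_nonneg_left h3 (S.mass_pos k).le
    linarith
  have h2 := S.sum_mass_mul_forceVec_mul z z₀
  have h3 : ∑ k, S.mass k * (z k - S.forceVec z k) * z₀ k =
      ∑ k, S.mass k * z k * z₀ k - ∑ k, S.mass k * S.forceVec z k * z₀ k := by
    rw [← Finset.sum_sub_distrib]
    exact Finset.sum_congr rfl fun k _ => by ring
  have hterm : ∀ a, ∀ b ∈ Finset.univ.erase a,
      0 ≤ S.coeff a b * (|z a - z b| ^ S.α * (z a - z b) * (z₀ a - z₀ b)) := by
    intro a b hb
    have hab := (Finset.ne_of_mem_erase hb).symm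
    rw [mul_assoc]
    exact mul_nonneg (S.coeff_pos_of_ne hpos hab).le
      (mul_nonneg (Real.rpow_nonneg (abs_nonneg _) _) (hz a b hab).le)
  have h4 : S.coeff i j * (|z i - z j| ^ S.α * (z i - z j) * (z₀ i - z₀ j)) ≤
      ∑ a, ∑ b ∈ Finset.univ.erase a,
        S.coeff a b * (|z a - z b| ^ S.α * (z a - z b) * (z₀ a - z₀ b)) :=
    (Finset.single_le_sum (hterm i) (Finset.mem_erase.2 ⟨hij.symm, Finset.mem_univ j⟩)).trans
      (Finset.single_le_sum (f := fun a => ∑ b ∈ Finset.univ.erase a,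
        S.coeff a b * (|z a - z b| ^ S.α * (z a - z b) * (z₀ a - z₀ b)))
        (fun a _ => Finset.sum_nonneg (hterm a)) (Finset.mem_univ i))
  have h5 : |z i - z j| ^ (S.α + 1) ≤ 2 * Q / (S.coeff i j * |z₀ i - z₀ j|) := by
    rw [le_div_iff₀ (mul_pos hc hd), Real.rpow_add_one hzd.ne']
    rw [mul_assoc (|z i - z j| ^ S.α), hp] at h4
    linarith
  have h6 : ε ≤ |z i - z j| := by
    by_contra hcon
    exact absurd (hε' ⟨hzd, not_le.1 hcon⟩) (not_lt.2 h5)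
  rw [hp]
  exact hδ.2.trans_le (by gcongr)

/-- Minimize the potential over the vectors whose gaps, weighted by those of z₀, are at least δ.
With δ small the constraint is inactive at the minimizer, which is therefore a critical point. -/
theorem exists_forceVec_eq_self [Nonempty (Fin n)] (hpos : ∀ i j, i < j → 0 < S.coeff i j)
    (hα : S.α < -1) {z₀ : Fin n → ℝ} (h₀ : ∀ i j, i ≠ j → z₀ i ≠ z₀ j) :
    ∃ z, SameOrder z₀ z ∧ S.forceVec z = z := by
  obtain ⟨Ψ, hΨ, C, D, hD, hΨ'⟩ := exists_primitive_neg_abs_rpow_mul_self hα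
  obtain ⟨R, hR⟩ := S.exists_bound_of_potential_le hpos hD hΨ' (S.potential Ψ z₀)
  -- The first condition on δ puts `z₀` into the constraint set `K`; the second will put the
  -- minimizer into its interior.
  have hev : ∀ᶠ δ in nhdsWithin (0 : ℝ) (Set.Ioi 0), ∀ i j, i ≠ j →
      (δ < (z₀ i - z₀ j) * (z₀ i - z₀ j) ∧ ∀ z, SameOrder z₀ z → ‖z‖ ≤ R →
      0 ≤ ∑ k, S.mass k * (z k - S.forceVec z k) * z₀ k →
      δ < (z i - z j) * (z₀ i - z₀ j)) := by
    refine Filter.eventually_all.2 fun i => Filter.eventually_all.2 fun j => ?_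
    by_cases hij : i = j
    · exact Filter.Eventually.of_forall fun _ h => absurd hij h
    · filter_upwards [S.eventually_lt_gap hpos hα h₀ R hij,
        Ioo_mem_nhdsGT (SameOrder.refl h₀ i j hij)] with δ h1 h2 _ using ⟨h2.2, h1⟩
  obtain ⟨δ, hδ, hδ0⟩ := (hev.and self_mem_nhdsWithin).exists
  have hδ0 : 0 < δ := hδ0
  let K : Set (Fin n → ℝ) := {z | ∀ i j, i ≠ j → δ ≤ (z i - z j) * (z₀ i - z₀ j)}
  have hKne : ∀ z ∈ K, SameOrder z₀ z := fun z hz i j hij => hδ0.trans_le (hz i j hij)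
  have hKclosed : IsClosed K := by
    simp only [K, Set.ofPred_forall]
    refine isClosed_iInter fun i => isClosed_iInter fun j => isClosed_iInter fun _ => ?_
    exact isClosed_le continuous_const (by fun_prop)
  have hz₀K : z₀ ∈ K := fun i j hij => (hδ i j hij).1.le
  have hcomp : IsCompact (Metric.closedBall (0 : Fin n → ℝ) R ∩ K) :=
    (isCompact_closedBall _ _).inter_right hKclosed
  have hcont : ContinuousOn (S.potential Ψ) (Metric.closedBall (0 : Fin n → ℝ) R ∩ K) := by
    unfold potential
    refine ContinuousOn.add (by fun_prop) (continuousOn_const.mul ?_)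
    refine continuousOn_finsetSum _ fun i _ => continuousOn_finsetSum _ fun j hj =>
      continuousOn_const.mul fun z hz => ContinuousAt.continuousWithinAt ?_
    have h1 := (hΨ (z i - z j) (sub_ne_zero.2
      ((hKne z hz.2).ne (Finset.ne_of_mem_erase hj).symm))).continuousAt
    exact ContinuousAt.comp (f := fun z : Fin n → ℝ => z i - z j) (g := Ψ) h1 (by fun_prop)
  obtain ⟨z, hzK, hmin⟩ := hcomp.exists_isMinOn
    ⟨z₀, mem_closedBall_zero_iff.2 (hR z₀ h₀ le_rfl), hz₀K⟩ hcont
  have hz := hKne z hzK.2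
  have hzR : ‖z‖ ≤ R := mem_closedBall_zero_iff.1 hzK.1
  have hne : ∀ i j, i ≠ j → z i ≠ z j := fun i j hij => hz.ne hij
  -- A competitor below the minimum would lie in the sublevel set of `z₀`, hence in the ball; so the
  -- minimum over the ball is a minimum over `K`.
  have hmin' : ∀ z' ∈ K, S.potential Ψ z ≤ S.potential Ψ z' := by
    intro z' hz'
    by_contra hcon
    rw [not_le] at hcon
    have h1 : S.potential Ψ z ≤ S.potential Ψ z₀ :=
      hmin ⟨mem_closedBall_zero_iff.2 (hR z₀ h₀ le_rfl), hz₀K⟩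
    have h2 := hR z' (fun i j hij => (hKne z' hz').ne hij) (hcon.le.trans h1)
    exact hcon.not_ge (hmin ⟨mem_closedBall_zero_iff.2 h2, hz'⟩)
  -- Adding a positive multiple of `z₀` only widens the weighted gaps, so this ray stays in `K` and
  -- the one-sided derivative along it is nonnegative.
  have hdir : 0 ≤ ∑ k, S.mass k * (z k - S.forceVec z k) * z₀ k := by
    refine ge_of_tendsto (S.hasDerivAt_potential hΨ hne z₀).tendsto_slope_zero_right ?_
    filter_upwards [self_mem_nhdsWithin] with t ht
    have ht : 0 < t := ht
    rw [zero_add, zero_smul, add_zero, smul_eq_mul]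
    refine mul_nonneg (inv_pos.2 ht).le (sub_nonneg.2 (hmin' _ fun i j hij => ?_))
    have h1 := hzK.2 i j hij
    have h2 := mul_nonneg ht.le (mul_self_nonneg (z₀ i - z₀ j))
    simp only [Pi.add_apply, Pi.smul_apply, smul_eq_mul]
    linarith
  have hint : K ∈ nhds z := by
    have h1 : ∀ᶠ z' in nhds z, ∀ i j, i ≠ j → δ ≤ (z' i - z' j) * (z₀ i - z₀ j) := by
      refine Filter.eventually_all.2 fun i => Filter.eventually_all.2 fun j => ?_
      by_cases hij : i = j
      · exact Filter.Eventually.of_forall fun _ h => absurd hij h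
      · have h2 : ContinuousAt (fun z' : Fin n → ℝ => (z' i - z' j) * (z₀ i - z₀ j)) z := by
          fun_prop
        filter_upwards [h2.eventually (lt_mem_nhds ((hδ i j hij).2 z hz hzR hdir))]
          with z' hz' _ using hz'.le
    exact h1
  refine ⟨z, hz, ?_⟩
  -- Along z - F(z) the derivative of the potential is the squared mass norm of z - F(z), which must
  -- vanish at an interior minimum.
  have hlin : ContinuousAt (fun t : ℝ => z + t • (z - S.forceVec z)) 0 := by fun_prop
  have hloc : IsLocalMin (fun t : ℝ => S.potential Ψ (z + t • (z - S.forceVec z))) 0 := by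
    filter_upwards [hlin.eventually_mem (by simpa using hint)] with t ht
    simpa using hmin' _ ht
  have hzero := hloc.hasDerivAt_eq_zero (S.hasDerivAt_potential hΨ hne _)
  have h6 : ∀ k ∈ Finset.univ, 0 ≤ S.mass k * (z k - S.forceVec z k) * (z - S.forceVec z) k := by
    intro k _
    rw [mul_assoc]
    exact mul_nonneg (S.mass_pos k).le (mul_self_nonneg _)
  have h7 := (Finset.sum_eq_zero_iff_of_nonneg h6).1 hzero
  funext k
  have h8 := h7 k (Finset.mem_univ k)
  rw [mul_assoc] at h8
  have h9 := (mul_eq_zero.1 h8).resolve_left (S.mass_pos k).ne'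
  exact (sub_eq_zero.1 (mul_self_eq_zero.1 h9)).symm

/-! ## The weighted inner product and the derivative of the force -/

/-- The inner product of configurations weighted by the masses. -/
def massInner (u v : Fin n → ℝ) : ℝ := ∑ i, S.mass i * u i * v i

theorem massInner_add_smul_left (u u' v : Fin n → ℝ) (a : ℝ) :
    S.massInner (u + a • u') v = S.massInner u v + a * S.massInner u' v := by
  simp only [massInner, Finset.mul_sum, ← Finset.sum_add_distrib]
  refine Finset.sum_congr rfl fun i _ => ?_
  simp only [Pi.add_apply, Pi.smul_apply, smul_eq_mul]
  ring

theorem massInner_smul_left (u v : Fin n → ℝ) (a : ℝ) :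
    S.massInner (a • u) v = a * S.massInner u v := by
  simp only [massInner, Finset.mul_sum]
  refine Finset.sum_congr rfl fun i _ => ?_
  simp only [Pi.smul_apply, smul_eq_mul]
  ring

theorem massInner_comm (u v : Fin n → ℝ) : S.massInner u v = S.massInner v u :=
  Finset.sum_congr rfl fun i _ => by ring

theorem massInner_self_nonneg (u : Fin n → ℝ) : 0 ≤ S.massInner u u :=
  Finset.sum_nonneg fun i _ => by
    rw [mul_assoc]; exact mul_nonneg (S.mass_pos i).le (mul_self_nonneg _)

theorem massInner_self_eq_zero {u : Fin n → ℝ} : S.massInner u u = 0 ↔ u = 0 := by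
  constructor
  · intro h
    have h6 : ∀ i ∈ Finset.univ, 0 ≤ S.mass i * u i * u i := fun i _ => by
      rw [mul_assoc]; exact mul_nonneg (S.mass_pos i).le (mul_self_nonneg _)
    have h7 := (Finset.sum_eq_zero_iff_of_nonneg h6).1 h
    funext i
    have h8 := h7 i (Finset.mem_univ i)
    rw [mul_assoc] at h8
    exact mul_self_eq_zero.1 ((mul_eq_zero.1 h8).resolve_left (S.mass_pos i).ne')
  · rintro rfl
    simp [massInner]

/-- The projection to the hyperplane along the diagonal. -/
def center : (Fin n → ℝ) →ₗ[ℝ] S.hyperplane ℝ :=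
  LinearMap.codRestrict (S.hyperplane ℝ)
    (LinearMap.id - ((∑ i, S.mass i)⁻¹ • ∑ i, S.mass i • LinearMap.proj (R := ℝ) i).smulRight
      (fun _ : Fin n => (1 : ℝ))) (by
    intro v
    show ∑ i, S.mass i * (v i - _ * 1) = 0
    rcases isEmpty_or_nonempty (Fin n) with h | h
    · simp
    · have hM : ∑ i, S.mass i ≠ 0 :=
        (Finset.sum_pos (fun i _ => S.mass_pos i) Finset.univ_nonempty).ne'
      simp only [mul_sub, Finset.sum_sub_distrib, ← Finset.sum_mul]
      simp [hM])

theorem center_apply (v : Fin n → ℝ) (i : Fin n) :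
    (S.center v).1 i = v i - (∑ i, S.mass i)⁻¹ * ∑ i, S.mass i * v i := by
  simp [center]

theorem center_coe (z : S.hyperplane ℝ) : S.center z.1 = z := by
  apply Subtype.ext
  funext i
  have h : ∑ i, S.mass i * z.1 i = 0 := z.2
  rw [center_apply, h, mul_zero, sub_zero]

theorem contDiffAt_forceVec {z : Fin n → ℝ} (hz : ∀ i j, i ≠ j → z i ≠ z j) :
    ContDiffAt ℝ 1 (fun z : Fin n → ℝ => S.forceVec z) z := by
  refine contDiffAt_pi.2 fun i => ?_
  simp only [forceVec_real]
  refine ContDiffAt.sum fun j hj => ?_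
  have h0 : z i - z j ≠ 0 := sub_ne_zero.2 (hz i j (Finset.ne_of_mem_erase hj).symm)
  have h1 : ContDiffAt ℝ 1 (fun z : Fin n → ℝ => z i - z j) z := by fun_prop
  have h2 : ContDiffAt ℝ 1 (fun z : Fin n → ℝ => |z i - z j|) z := 
    ContDiffAt.comp (g := fun t : ℝ => |t|) (f := fun z : Fin n → ℝ => z i - z j) z
      (contDiffAt_abs h0) h1
  exact (contDiffAt_const.mul (h2.rpow_const_of_ne (abs_ne_zero.2 h0))).mul h1

theorem contDiffAt_force {z : S.hyperplane ℝ} (hz : ∀ i j, i ≠ j → z.1 i ≠ z.1 j) :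
    ContDiffAt ℝ 1 (S.force (𝕜 := ℝ)) z := by
  have h1 : ContDiffAt ℝ 1 (fun z : S.hyperplane ℝ => S.forceVec z.1) z :=
    ContDiffAt.comp (g := fun z : Fin n → ℝ => S.forceVec z)
      (f := fun z : S.hyperplane ℝ => z.1) z (S.contDiffAt_forceVec hz)
      (S.hyperplane ℝ).subtypeL.contDiff.contDiffAt
  -- Composing with the linear retraction `center` transfers smoothness from the ambient space to
  -- maps into the hyperplane.
  have h2 : S.force (𝕜 := ℝ) = fun z => LinearMap.toContinuousLinearMap S.center (S.forceVec z.1) :=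
    funext fun z => (S.center_coe (S.force z)).symm
  rw [h2]
  exact (LinearMap.toContinuousLinearMap S.center).contDiff.contDiffAt.comp z h1

/-- Differentiating the weak form of the force gives a symmetric form in u and v, whose sign on the
diagonal is that of α + 1 when the coefficients are positive. -/
theorem massInner_fderiv_force {z : S.hyperplane ℝ} (hz : ∀ i j, i ≠ j → z.1 i ≠ z.1 j)
    (u : S.hyperplane ℝ) (v : Fin n → ℝ) :
    S.massInner (fderiv ℝ S.force z u).1 v = 1 / 2 * ∑ i, ∑ j ∈ Finset.univ.erase i,
      S.coeff i j * ((S.α + 1) * |z.1 i - z.1 j| ^ S.α * (u.1 i - u.1 j) * (v i - v j)) := by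
  have hl : HasDerivAt (fun t : ℝ => z + t • u) u 0 := by
    simpa using ((hasDerivAt_id (0 : ℝ)).smul_const u).const_add z
  have h0 : z = z + (0 : ℝ) • u := by simp
  have h1 : HasDerivAt (fun t : ℝ => S.force (z + t • u)) (fderiv ℝ S.force z u) 0 := by
    have := ((S.contDiffAt_force hz).differentiableAt one_ne_zero).hasFDerivAt
    exact HasFDerivAt.comp_hasDerivAt (l := S.force (𝕜 := ℝ)) (0 : ℝ) (by rwa [← h0]) hl
  have h2 : HasDerivAt (fun t : ℝ => (S.force (z + t • u)).1) (fderiv ℝ S.force z u).1 0 :=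
    (S.hyperplane ℝ).subtypeL.hasFDerivAt.comp_hasDerivAt 0 h1
  have h3 : HasDerivAt (fun t : ℝ => S.massInner (S.force (z + t • u)).1 v)
      (S.massInner (fderiv ℝ S.force z u).1 v) 0 :=
    HasDerivAt.fun_sum fun i _ => ((hasDerivAt_pi.1 h2 i).const_mul _).mul_const _
  refine h3.unique ?_
  have h4 : (fun t : ℝ => S.massInner (S.force (z + t • u)).1 v) = fun t : ℝ =>
      1 / 2 * ∑ i, ∑ j ∈ Finset.univ.erase i, S.coeff i j *
        (|(z.1 i - z.1 j) + t * (u.1 i - u.1 j)| ^ S.α *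
          ((z.1 i - z.1 j) + t * (u.1 i - u.1 j)) * (v i - v j)) := by
    funext t
    refine (S.sum_mass_mul_forceVec_mul _ v).trans ?_
    have h5 : ∀ i j, (z + t • u).1 i - (z + t • u).1 j =
        (z.1 i - z.1 j) + t * (u.1 i - u.1 j) := by
      intro i j
      show (z.1 i + t * u.1 i) - (z.1 j + t * u.1 j) = _
      ring
    simp only [h5]
  rw [h4]
  refine HasDerivAt.const_mul _ (HasDerivAt.fun_sum fun i _ => HasDerivAt.fun_sum fun j hj =>
    HasDerivAt.const_mul _ (HasDerivAt.mul_const ?_ _))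
  have h6 := hasDerivAt_abs_rpow_mul_self S.α
    (sub_ne_zero.2 (hz i j (Finset.ne_of_mem_erase hj).symm))
  have h7 : HasDerivAt (fun t : ℝ => (z.1 i - z.1 j) + t * (u.1 i - u.1 j)) (u.1 i - u.1 j) 0 := by
    simpa using ((hasDerivAt_id (0 : ℝ)).mul_const (u.1 i - u.1 j)).const_add (z.1 i - z.1 j)
  exact HasDerivAt.comp (h₂ := fun s : ℝ => |s| ^ S.α * s) (0 : ℝ) (by simpa using h6) h7

theorem massInner_force_self_nonneg (hpos : ∀ i j, i < j → 0 < S.coeff i j) (z : Fin n → ℝ) :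
    0 ≤ S.massInner (S.forceVec z) z := by
  rw [massInner, S.sum_mass_mul_forceVec_mul]
  refine mul_nonneg (by norm_num) (Finset.sum_nonneg fun i _ => Finset.sum_nonneg fun j hj => ?_)
  rw [mul_assoc (|z i - z j| ^ S.α)]
  exact mul_nonneg (S.coeff_pos_of_ne hpos (Finset.ne_of_mem_erase hj).symm).le
    (mul_nonneg (Real.rpow_nonneg (abs_nonneg _) _) (mul_self_nonneg _))

/-- Pairing with z gives l⟨z, z⟩ = ⟨F(z), z⟩ ≥ 0. Positivity of l is needed for the rescaling to l =
1 and for the sign of l⁻¹ DF. -/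
theorem eigenvalue_pos (hpos : ∀ i j, i < j → 0 < S.coeff i j) {z : S.hyperplane ℝ}
    (hz : S.force z ≠ 0) {l : ℝ} (hl : S.force z = l • z) : 0 < l := by
  have hl0 : l ≠ 0 := by
    rintro rfl
    exact hz (by rw [hl, zero_smul])
  have h1 : S.massInner (S.forceVec z.1) z.1 = l * S.massInner z.1 z.1 := by
    rw [← massInner_smul_left]
    exact congrArg (fun w : S.hyperplane ℝ => S.massInner w.1 z.1) hl
  have hz0 : S.massInner z.1 z.1 ≠ 0 := by
    intro h
    have : z = 0 := Subtype.ext (S.massInner_self_eq_zero.1 h)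
    exact hz (by rw [hl, this, smul_zero])
  have h2 := S.massInner_force_self_nonneg hpos z.1
  rw [h1] at h2
  exact (nonneg_of_mul_nonneg_left h2
    (lt_of_le_of_ne (S.massInner_self_nonneg _) hz0.symm)).lt_of_ne hl0.symm

/-- A fixed line of the force is nondegenerate. -/
theorem exists_eq_smul_of_eq_fderiv_force (hpos : ∀ i j, i < j → 0 < S.coeff i j)
    (hα : S.α < -1) {z : S.hyperplane ℝ} (hz : ∀ i j, i ≠ j → z.1 i ≠ z.1 j)
    (hz0 : z ≠ 0) {l : ℝ} (hl : S.force z = l • z) (hl0 : 0 < l) {s : ℝ} (hs : 0 ≤ s)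
    {u : S.hyperplane ℝ} {a : ℝ} (hu : u = s • (l⁻¹ • fderiv ℝ S.force z u) + a • z) :
    ∃ b : ℝ, u = b • z := by
  -- Split off the mass-orthogonal projection of `u` to the line of `z`; the remainder `u'` will be
  -- shown to vanish.
  set b : ℝ := S.massInner u.1 z.1 / S.massInner z.1 z.1 with hb
  have hzz : S.massInner z.1 z.1 ≠ 0 := fun h =>
    hz0 (Subtype.ext (S.massInner_self_eq_zero.1 h))
  set u' : S.hyperplane ℝ := u + (-b) • z with hu'
  have horth : S.massInner z.1 u'.1 = 0 := by
    rw [massInner_comm]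
    refine (S.massInner_add_smul_left u.1 z.1 z.1 (-b)).trans ?_
    rw [hb]; field_simp; ring
  have h1 : u = u' + b • z := by rw [hu']; module
  -- Euler's identity in weak form: DF(z) z = (α + 1) F(z) = (α + 1) l z, which is orthogonal to
  -- `u'`.
  have hAz : S.massInner (fderiv ℝ S.force z z).1 u'.1 = 0 := by
    have h2 := S.sum_mass_mul_forceVec_mul z.1 u'.1
    have h3 : S.massInner (S.forceVec z.1) u'.1 = 0 := by
      have : S.massInner (S.forceVec z.1) u'.1 = l * S.massInner z.1 u'.1 := by
        rw [← massInner_smul_left]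
        exact congrArg (fun w : S.hyperplane ℝ => S.massInner w.1 u'.1) hl
      rw [this, horth, mul_zero]
    rw [S.massInner_fderiv_force hz]
    have h4 : 1 / 2 * ∑ i, ∑ j ∈ Finset.univ.erase i, S.coeff i j *
        ((S.α + 1) * |z.1 i - z.1 j| ^ S.α * (z.1 i - z.1 j) * (u'.1 i - u'.1 j)) =
        (S.α + 1) * S.massInner (S.forceVec z.1) u'.1 := by
      rw [massInner, h2, mul_left_comm, Finset.mul_sum (a := S.α + 1)]
      simp only [Finset.mul_sum (a := S.α + 1)]
      congr 1
      exact Finset.sum_congr rfl fun i _ => Finset.sum_congr rfl fun j _ => by ring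
    rw [h4, h3, mul_zero]
  have hAu : S.massInner (fderiv ℝ S.force z u').1 u'.1 ≤ 0 := by
    rw [S.massInner_fderiv_force hz]
    refine mul_nonpos_of_nonneg_of_nonpos (by norm_num) (Finset.sum_nonpos fun i _ =>
      Finset.sum_nonpos fun j hj => mul_nonpos_of_nonneg_of_nonpos
        (S.coeff_pos_of_ne hpos (Finset.ne_of_mem_erase hj).symm).le ?_)
    rw [mul_assoc]
    exact mul_nonpos_of_nonpos_of_nonneg (mul_nonpos_of_nonpos_of_nonneg (by linarith)
      (Real.rpow_nonneg (abs_nonneg _) _)) (mul_self_nonneg _)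
  have h5 : u'.1 = ((s * l⁻¹) • (fderiv ℝ S.force z u').1 +
      (s * l⁻¹ * b) • (fderiv ℝ S.force z z).1) + (a - b) • z.1 := by
    have h6 : u' = ((s * l⁻¹) • fderiv ℝ S.force z u' +
        (s * l⁻¹ * b) • fderiv ℝ S.force z z) + (a - b) • z := by
      have h7 : fderiv ℝ S.force z u = fderiv ℝ S.force z u' + b • fderiv ℝ S.force z z := by
        conv_lhs => rw [h1]
        rw [map_add, map_smul]
      rw [h7] at hu
      have h8 : u' = u + (-b) • z := hu'
      rw [hu] at h8
      refine h8.trans ?_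
      module
    exact congrArg Subtype.val h6
  -- Pairing the equation for `u'` with `u'` kills both terms along `z` and leaves only the
  -- nonpositive diagonal value of DF.
  have h9 : S.massInner u'.1 u'.1 = s * l⁻¹ * S.massInner (fderiv ℝ S.force z u').1 u'.1 := by
    conv_lhs => enter [2]; rw [h5]
    rw [massInner_add_smul_left, massInner_add_smul_left, massInner_smul_left, hAz, horth]
    ring
  have h10 : S.massInner u'.1 u'.1 ≤ 0 := by
    rw [h9]
    exact mul_nonpos_of_nonneg_of_nonpos (mul_nonneg hs (inv_pos.2 hl0).le) hAu
  have h11 : u' = 0 :=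
    Subtype.ext (S.massInner_self_eq_zero.1 (le_antisymm h10 (S.massInner_self_nonneg _)))
  exact ⟨b, by rw [h1, h11, zero_add]⟩

/-! ## The cells of collinear configurations with a given order -/

theorem SameOrder.ne_zero (hn : 2 ≤ n) {z₀ : Fin n → ℝ} {z : S.hyperplane ℝ}
    (h : SameOrder z₀ z.1) : z ≠ 0 := by
  have : Nontrivial (Fin n) := Fin.nontrivial_iff_two_le.2 hn
  obtain ⟨i, j, hij⟩ := exists_pair_ne (Fin n)
  rintro rfl
  exact h.ne hij rfl

/-- The collinear configurations whose bodies are in the order of `z₀`, up to reflection. -/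
def cell (z₀ : Fin n → ℝ) : Set (ℙ ℝ (S.hyperplane ℝ)) :=
  {p | ∃ (z : S.hyperplane ℝ) (hz : z ≠ 0),
    SameOrder z₀ z.1 ∧ p = Projectivization.mk ℝ z hz}

theorem mk_mem_cell {z₀ : Fin n → ℝ} {z : S.hyperplane ℝ} (hz : z ≠ 0) :
    Projectivization.mk ℝ z hz ∈ S.cell z₀ ↔ SameOrder z₀ z.1 ∨ SameOrder z₀ (-z.1) := by
  constructor
  · rintro ⟨z', hz', h, he⟩
    obtain ⟨a, ha⟩ := (Projectivization.mk_eq_mk_iff' ℝ _ _ hz hz').1 he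
    have ha1 : z.1 = a • z'.1 := congrArg Subtype.val ha.symm
    rcases lt_trichotomy a 0 with h0 | h0 | h0
    · right
      rw [ha1, ← neg_smul]
      exact h.smul (neg_pos.2 h0)
    · exact absurd (by rw [← ha, h0, zero_smul]) hz
    · left
      rw [ha1]
      exact h.smul h0
  · rintro (h | h)
    · exact ⟨z, hz, h, rfl⟩
    · refine ⟨-z, neg_ne_zero.2 hz, h, ?_⟩
      rw [Projectivization.mk_eq_mk_iff']
      exact ⟨-1, by simp⟩

theorem ne_of_mk_mem_cell {z₀ : Fin n → ℝ} {z : S.hyperplane ℝ} (hz : z ≠ 0)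
    (h : Projectivization.mk ℝ z hz ∈ S.cell z₀) {i j : Fin n} (hij : i ≠ j) :
    z.1 i ≠ z.1 j := by
  rcases (S.mk_mem_cell hz).1 h with h' | h'
  · exact h'.ne hij
  · exact fun h0 => h'.ne hij (by simp only [Pi.neg_apply, h0])

theorem isOpen_setOf_sameOrder (z₀ : Fin n → ℝ) : IsOpen {z : Fin n → ℝ | SameOrder z₀ z} := by
  simp only [SameOrder, Set.ofPred_forall]
  refine isOpen_iInter_of_finite fun i => isOpen_iInter_of_finite fun j =>
    isOpen_iInter_of_finite fun _ => ?_
  exact isOpen_lt continuous_const (by fun_prop)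

theorem isOpen_cell (z₀ : Fin n → ℝ) : IsOpen (S.cell z₀) := by
  rw [Projectivization.isOpen_iff]
  have h : Projectivization.mk' ℝ ⁻¹' S.cell z₀ =
      {z : {z : S.hyperplane ℝ // z ≠ 0} | SameOrder z₀ z.1.1} ∪
        {z | SameOrder z₀ (-z.1.1)} := by
    ext z
    exact S.mk_mem_cell z.2
  rw [h]
  refine IsOpen.union ?_ ?_
  · exact (isOpen_setOf_sameOrder z₀).preimage
      (f := fun z : {z : S.hyperplane ℝ // z ≠ 0} => z.1.1) (by fun_prop)
  · exact (isOpen_setOf_sameOrder z₀).preimage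
      (f := fun z : {z : S.hyperplane ℝ // z ≠ 0} => -z.1.1) (by fun_prop)

/-- The cone of one order is convex, and already this cone maps onto the cell, since the opposite
cone spans the same lines. -/
theorem isPreconnected_cell (hn : 2 ≤ n) (z₀ : Fin n → ℝ) : IsPreconnected (S.cell z₀) := by
  have h1 : Convex ℝ {z : S.hyperplane ℝ | SameOrder z₀ z.1} := by
    intro x hx y hy a b ha hb hab i j hij
    have h2 := hx i j hij
    have h3 := hy i j hij
    show 0 < ((a * x.1 i + b * y.1 i) - (a * x.1 j + b * y.1 j)) * (z₀ i - z₀ j)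
    rcases ha.eq_or_lt with rfl | ha'
    · rw [zero_add] at hab
      subst hab
      linarith
    · have := mul_pos ha' h2
      have := mul_nonneg hb h3.le
      linarith
  have h2 : IsPreconnected {z : {z : S.hyperplane ℝ // z ≠ 0} | SameOrder z₀ z.1.1} := by
    have hind : Topology.IsInducing (Subtype.val : {z : S.hyperplane ℝ // z ≠ 0} → _) :=
      Topology.IsInducing.subtypeVal
    rw [← hind.isPreconnected_image]
    convert h1.isPreconnected using 1
    ext z
    constructor
    · rintro ⟨z', h, rfl⟩
      exact h
    · exact fun h => ⟨⟨z, SameOrder.ne_zero S hn h⟩, h, rfl⟩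
  convert h2.image (Projectivization.mk' ℝ) Projectivization.continuous_mk'.continuousOn using 1
  ext p
  constructor
  · rintro ⟨z, hz, h, rfl⟩
    exact ⟨⟨z, hz⟩, h, rfl⟩
  · rintro ⟨z, h, rfl⟩
    exact ⟨z.1, z.2, h, rfl⟩

theorem cell_subset_configurations (z₀ : Fin n → ℝ) : S.cell z₀ ⊆ S.configurations ℝ := by
  rintro p ⟨z, hz, h, rfl⟩
  exact ⟨z, hz, fun i j hij => h.ne hij, rfl⟩

theorem cell_eq_of_sameOrder {z₀ z₁ : Fin n → ℝ} (h : SameOrder z₀ z₁) :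
    S.cell z₀ = S.cell z₁ := by
  ext p
  exact ⟨fun ⟨z, hz, hz', hp⟩ => ⟨z, hz, h.symm.trans hz', hp⟩,
    fun ⟨z, hz, hz', hp⟩ => ⟨z, hz, h.trans hz', hp⟩⟩

theorem cell_neg (z₀ : Fin n → ℝ) : S.cell (-z₀) = S.cell z₀ := by
  ext p
  induction p with
  | h z hz =>
    rw [mk_mem_cell, mk_mem_cell]
    constructor
    · rintro (h | h)
      · exact Or.inr (by simpa using h.neg_neg)
      · exact Or.inl (by simpa using h.neg_neg)
    · rintro (h | h)
      · exact Or.inr h.neg_neg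
      · exact Or.inl (by simpa using h.neg_neg)

theorem cell_eq_of_mem_of_mem {z₀ z₁ : Fin n → ℝ} {p : ℙ ℝ (S.hyperplane ℝ)}
    (h₀ : p ∈ S.cell z₀) (h₁ : p ∈ S.cell z₁) : S.cell z₀ = S.cell z₁ := by
  obtain ⟨z, hz, h, rfl⟩ := h₀
  rw [S.cell_eq_of_sameOrder h]
  rcases (S.mk_mem_cell hz).1 h₁ with h' | h'
  · rw [S.cell_eq_of_sameOrder h']
  · rw [S.cell_eq_of_sameOrder h', cell_neg]

theorem connectedComponentIn_configurations (hn : 2 ≤ n) {z₀ : Fin n → ℝ}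
    {p : ℙ ℝ (S.hyperplane ℝ)} (hp : p ∈ S.cell z₀) :
    connectedComponentIn (S.configurations ℝ) p = S.cell z₀ := by
  refine Set.Subset.antisymm ?_ ((S.isPreconnected_cell hn z₀).subset_connectedComponentIn hp
    (S.cell_subset_configurations z₀))
  have hpX := S.cell_subset_configurations z₀ hp
  -- The union of the other cells is open and disjoint from this one, and together they cover the
  -- configurations; a connected set meeting the cell cannot leave it.
  let O : Set (ℙ ℝ (S.hyperplane ℝ)) := ⋃ z₁ ∈ {z₁ : Fin n → ℝ | S.cell z₁ ≠ S.cell z₀}, S.cell z₁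
  have hO : IsOpen O := isOpen_biUnion fun z₁ _ => S.isOpen_cell z₁
  refine isPreconnected_connectedComponentIn.subset_left_of_subset_union (S.isOpen_cell z₀) hO
    ?_ ?_ ⟨p, mem_connectedComponentIn hpX, hp⟩
  · refine Set.disjoint_left.2 fun q hq hqO => ?_
    obtain ⟨z₁, h₁, hq₁⟩ := Set.mem_iUnion₂.1 hqO
    exact h₁ (S.cell_eq_of_mem_of_mem hq₁ hq)
  · refine (connectedComponentIn_subset _ _).trans ?_
    rintro q ⟨z₁, hz₁, h, rfl⟩
    have hq : Projectivization.mk ℝ z₁ hz₁ ∈ S.cell z₁.1 := ⟨z₁, hz₁, SameOrder.refl h, rfl⟩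
    by_cases he : S.cell z₁.1 = S.cell z₀
    · exact Or.inl (he ▸ hq)
    · exact Or.inr (Set.mem_iUnion₂.2 ⟨z₁.1, he, hq⟩)

/-! ### Counting the cells by permutations. -/

/-- The vector in which the bodies are in the order given by a permutation. -/
def permVec (σ : Equiv.Perm (Fin n)) (i : Fin n) : ℝ := ((σ i : ℕ) : ℝ)

theorem permVec_ne (σ : Equiv.Perm (Fin n)) (i j : Fin n) (hij : i ≠ j) :
    permVec σ i ≠ permVec σ j := by
  intro h
  exact hij (σ.injective (Fin.ext (Nat.cast_injective h)))

/-- Moving the center of mass to the origin is a translation, which preserves all differences. -/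
theorem cell_nonempty (hn : 2 ≤ n) {z₀ : Fin n → ℝ} (h₀ : ∀ i j, i ≠ j → z₀ i ≠ z₀ j) :
    (S.cell z₀).Nonempty := by
  have h : SameOrder z₀ (S.center z₀).1 := by
    intro i j hij
    rw [center_apply, center_apply, sub_sub_sub_cancel_right]
    exact SameOrder.refl h₀ i j hij
  exact ⟨_, S.center z₀, SameOrder.ne_zero S hn h, h, rfl⟩

theorem exists_perm_sameOrder {z : Fin n → ℝ} (hz : ∀ i j, i ≠ j → z i ≠ z j) :
    ∃ σ : Equiv.Perm (Fin n), SameOrder z (permVec σ) := by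
  -- `Tuple.sort z` sends a rank to a body, so its inverse gives each body its rank.
  refine ⟨(Tuple.sort z).symm, ?_⟩
  have key : ∀ i j, z i < z j → permVec (Tuple.sort z).symm i < permVec (Tuple.sort z).symm j := by
    intro i j hij
    by_contra hcon
    have h1 : (Tuple.sort z).symm j ≤ (Tuple.sort z).symm i := by
      have := not_lt.1 hcon
      simp only [permVec, Nat.cast_le] at this
      exact this
    have h2 := Tuple.monotone_sort z h1
    simp only [Function.comp_apply, Equiv.apply_symm_apply] at h2
    exact absurd hij (not_lt.2 h2)
  intro i j hij
  rcases lt_or_gt_of_ne (hz i j hij) with h | h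
  · exact mul_pos_of_neg_of_neg (sub_neg.2 (key i j h)) (sub_neg.2 h)
  · exact mul_pos (sub_pos.2 (key j i h)) (sub_pos.2 h)

/-- The composite of one permutation with the inverse of the other is strictly increasing on `Fin
n`, hence the identity. -/
theorem eq_of_sameOrder_permVec {σ τ : Equiv.Perm (Fin n)}
    (h : SameOrder (permVec σ) (permVec τ)) : σ = τ := by
  have hmono : StrictMono (τ ∘ σ.symm) := by
    intro a b hab
    have h1 := h (σ.symm a) (σ.symm b) (fun h' => hab.ne (σ.symm.injective h'))
    simp only [permVec, Equiv.apply_symm_apply] at h1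
    have h2 : ((a : ℕ) : ℝ) - ((b : ℕ) : ℝ) < 0 := sub_neg.2 (by exact_mod_cast hab)
    have h3 := sub_neg.1 (neg_of_mul_pos_left h1 h2.le)
    exact_mod_cast h3
  have h1 : τ ∘ σ.symm = id := Set.range_injOn_strictMono hmono strictMono_id
    (by rw [(τ.surjective.comp σ.symm.surjective).range_eq, Set.range_id])
  ext a
  have h2 := congrFun h1 (σ a)
  simp only [Function.comp_apply, Equiv.symm_apply_apply, id] at h2
  rw [h2]

theorem sameOrder_permVec_rev (σ : Equiv.Perm (Fin n)) :
    SameOrder (-permVec σ) (permVec (Fin.revPerm * σ)) := by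
  intro i j hij
  have h : ∀ k, permVec (Fin.revPerm * σ) k = n - 1 - permVec σ k := by
    intro k
    have h1 : (σ k : ℕ) + 1 ≤ n := (σ k).2
    simp only [permVec, Equiv.Perm.mul_apply, Fin.revPerm_apply, Fin.val_rev, Nat.cast_sub h1]
    push_cast
    ring
  have h2 := SameOrder.refl (permVec_ne σ) i j hij
  rw [h, h]
  simp only [Pi.neg_apply]
  linarith

theorem cell_permVec_eq_iff (hn : 2 ≤ n) {σ τ : Equiv.Perm (Fin n)} :
    S.cell (permVec τ) = S.cell (permVec σ) ↔ τ = σ ∨ τ = Fin.revPerm * σ := by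
  constructor
  · intro h
    obtain ⟨p, hp⟩ := S.cell_nonempty hn (permVec_ne τ)
    have hp' := hp
    rw [h] at hp'
    obtain ⟨z, hz, h1, rfl⟩ := hp
    rcases (S.mk_mem_cell hz).1 hp' with h2 | h2
    · exact Or.inl (eq_of_sameOrder_permVec (h1.trans h2.symm))
    · refine Or.inr (eq_of_sameOrder_permVec (h1.trans ?_))
      have h3 := h2.symm.neg_neg
      rw [neg_neg] at h3
      exact h3.trans (sameOrder_permVec_rev σ)
  · rintro (rfl | rfl)
    · rfl
    · rw [← S.cell_eq_of_sameOrder (sameOrder_permVec_rev σ), cell_neg]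

theorem components_eq_range (hn : 2 ≤ n) :
    connectedComponentIn (S.configurations ℝ) '' S.configurations ℝ =
      Set.range fun σ : Equiv.Perm (Fin n) => S.cell (permVec σ) := by
  ext V
  constructor
  · rintro ⟨p, ⟨z, hz, h, rfl⟩, rfl⟩
    obtain ⟨σ, hσ⟩ := exists_perm_sameOrder h
    refine ⟨σ, (S.connectedComponentIn_configurations hn ?_).symm⟩
    exact ⟨z, hz, hσ.symm, rfl⟩
  · rintro ⟨σ, rfl⟩
    obtain ⟨p, hp⟩ := S.cell_nonempty hn (permVec_ne σ)
    exact ⟨p, S.cell_subset_configurations _ hp, S.connectedComponentIn_configurations hn hp⟩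

/-- The map from permutations to cells has fibres {σ, rev σ}. They have two elements because
reversal moves 0 to n - 1, which differs from 0 for n ≥ 2. -/
theorem ncard_components (hn : 2 ≤ n) :
    (connectedComponentIn (S.configurations ℝ) '' S.configurations ℝ).ncard =
      n.factorial / 2 := by
  classical
  rw [S.components_eq_range hn]
  set D : Equiv.Perm (Fin n) → Set (ℙ ℝ (S.hyperplane ℝ)) := fun σ => S.cell (permVec σ) with hD
  have h1 : Set.range D = ((Finset.univ.image D : Finset _) : Set _) := by simp
  rw [h1, Set.ncard_coe_finset]
  have h2 := Finset.card_eq_sum_card_image D Finset.univ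
  have h3 : ∀ V ∈ Finset.univ.image D, (Finset.univ.filter fun τ => D τ = V).card = 2 := by
    intro V hV
    obtain ⟨σ, -, rfl⟩ := Finset.mem_image.1 hV
    have h4 : (Finset.univ.filter fun τ => D τ = D σ) = {σ, Fin.revPerm * σ} := by
      ext τ
      simp only [Finset.mem_filter, Finset.mem_univ, true_and, Finset.mem_insert,
        Finset.mem_singleton]
      exact S.cell_permVec_eq_iff hn
    rw [h4, Finset.card_pair]
    intro h
    have h5 : (Fin.revPerm : Equiv.Perm (Fin n)) = 1 := mul_eq_right.1 h.symm
    have h6 := congrArg (fun π : Equiv.Perm (Fin n) => (π ⟨0, by omega⟩ : ℕ)) h5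
    simp only [Fin.revPerm_apply, Fin.val_rev, Equiv.Perm.one_apply] at h6
    omega
  rw [Finset.sum_congr rfl h3, Finset.sum_const, Finset.card_univ, Fintype.card_perm,
    Fintype.card_fin, smul_eq_mul] at h2
  omega

/-! ## The fixed points and their index -/

theorem selfMap_mk_of_mem_cell (hn : 2 ≤ n) (hpos : ∀ i j, i < j → 0 < S.coeff i j)
    {z₀ : Fin n → ℝ} {z : S.hyperplane ℝ} (hz : z ≠ 0)
    (h : Projectivization.mk ℝ z hz ∈ S.cell z₀) :
    ContDiffAt ℝ 1 (S.force (𝕜 := ℝ)) z ∧ ∃ hF : S.force z ≠ 0,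
      S.selfMap (Projectivization.mk ℝ z hz) = Projectivization.mk ℝ (S.force z) hF := by
  have hne := fun i j => S.ne_of_mk_mem_cell hz h (i := i) (j := j)
  have hF := S.force_ne_zero hn hpos hne
  exact ⟨S.contDiffAt_force hne, hF, S.selfMap_mk hz hF⟩

theorem exists_fixedPoints_eq_singleton (hn : 2 ≤ n) (hpos : ∀ i j, i < j → 0 < S.coeff i j)
    (hα : S.α < -1) {z₀ : Fin n → ℝ} (h₀ : ∀ i j, i ≠ j → z₀ i ≠ z₀ j) :
    ∃ p, {q | q ∈ S.cell z₀ ∧ S.selfMap (𝕜 := ℝ) q = q} = {p} := by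
  have : Nonempty (Fin n) := ⟨⟨0, by omega⟩⟩
  obtain ⟨x, hx, hFx⟩ := S.exists_forceVec_eq_self hpos hα h₀
  let y : S.hyperplane ℝ := ⟨x, hFx ▸ S.forceVec_mem x⟩
  have hFy : S.force y = y := Subtype.ext hFx
  have hy : y ≠ 0 := SameOrder.ne_zero S hn (z := y) hx
  have hFy0 : S.force y ≠ 0 := by rwa [hFy]
  refine ⟨Projectivization.mk ℝ y hy, Set.eq_singleton_iff_unique_mem.2 ⟨⟨?_, ?_⟩, ?_⟩⟩
  · exact ⟨y, hy, hx, rfl⟩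
  · rw [S.selfMap_mk hy hFy0]
    congr 1
  · rintro q ⟨⟨z, hz, h, rfl⟩, hfix⟩
    have hF := S.force_ne_zero hn hpos (fun i j hij => h.ne hij)
    rw [S.selfMap_mk hz hF, Projectivization.mk_eq_mk_iff'] at hfix
    obtain ⟨l, hl⟩ := hfix
    have hl0 := S.eigenvalue_pos hpos hF hl.symm
    -- By homogeneity F(r z) = r^α l (r z), so `r` is the solution of r^α l = 1. The rescaled vector
    -- is then a solution of F(z) = z in the same cone as `y`.
    set r : ℝ := l ^ (-S.α⁻¹) with hr
    have hr0 : 0 < r := Real.rpow_pos_of_pos hl0 _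
    have hα0 : S.α ≠ 0 := by linarith
    have hrα : r ^ S.α * l = 1 := by
      rw [hr, ← Real.rpow_mul hl0.le, neg_mul, inv_mul_cancel₀ hα0, Real.rpow_neg_one,
        inv_mul_cancel₀ hl0.ne']
    have hrz : S.force (r • z) = r • z := by
      rw [force_smul, ← hl, Real.norm_of_nonneg hr0.le, RCLike.ofReal_real_eq_id, id, smul_smul,
        smul_smul, show r ^ S.α * r * l = (r ^ S.α * l) * r by ring, hrα, one_mul]
    have hyz : y.1 = (r • z).1 := S.eq_of_forceVec_eq_self hpos hα
      (hx.symm.trans (h.smul hr0)) hFx (congrArg Subtype.val hrz)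
    rw [Projectivization.mk_eq_mk_iff']
    refine ⟨r⁻¹, ?_⟩
    rw [show y = r • z from Subtype.ext hyz, inv_smul_smul₀ hr0.ne']

theorem hasFixedPointIndex_cell (hn : 2 ≤ n) (hpos : ∀ i j, i < j → 0 < S.coeff i j)
    (hα : S.α < -1) {z₀ : Fin n → ℝ} (h₀ : ∀ i j, i ≠ j → z₀ i ≠ z₀ j) :
    HasFixedPointIndex (S.selfMap (𝕜 := ℝ)) (S.cell z₀) 1 := by
  obtain ⟨p, hp⟩ := S.exists_fixedPoints_eq_singleton hn hpos hα h₀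
  refine ⟨S.isOpen_cell z₀, ?_, by rw [hp]; exact isCompact_singleton, ?_, fun c hc => ?_⟩
  · refine Projectivization.continuousOn_of_lift (F := S.force) (S.isOpen_cell z₀) fun z hz h => ?_
    obtain ⟨h1, h2⟩ := S.selfMap_mk_of_mem_cell hn hpos hz h
    exact ⟨h1.continuousAt, h2⟩
  · rw [hp]
    induction p with
    | h z hz =>
      -- A nonzero coordinate of the fixed point, normalized to 1 there, defines a chart around it.
      obtain ⟨i, hi⟩ : ∃ i, z.1 i ≠ 0 := by
        by_contra! hcon
        exact hz (Subtype.ext (funext hcon))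
      let c : AffineChart (S.hyperplane ℝ) :=
        { form := (z.1 i)⁻¹ • (LinearMap.proj i ∘ₗ (S.hyperplane ℝ).subtype)
          base := z
          form_base := by simp [hi] }
      refine ⟨c, Set.singleton_subset_iff.2 ((c.mk_mem_domain hz).2 ?_)⟩
      rw [show c.form z = 1 from c.form_base]
      exact one_ne_zero
  · rw [hp, Set.singleton_subset_iff] at hc
    refine c.hasFixedPointIndexOn_one (S.isOpen_cell z₀)
      (fun z hz h => S.selfMap_mk_of_mem_cell hn hpos hz h) hp hc ?_
    intro z hz hzp l hl s hs u a hu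
    have hzc : Projectivization.mk ℝ z hz ∈ S.cell z₀ := by
      have : p ∈ {q | q ∈ S.cell z₀ ∧ S.selfMap (𝕜 := ℝ) q = q} := by rw [hp]; rfl
      rw [hzp]; exact this.1
    have hne := fun i j => S.ne_of_mk_mem_cell hz hzc (i := i) (j := j)
    exact S.exists_eq_smul_of_eq_fderiv_force hpos hα hne hz hl
      (S.eigenvalue_pos hpos (S.force_ne_zero hn hpos hne) hl) hs hu

end BodySystem

end

theorem mainTheorem2 (n : ℕ) (hn : 3 ≤ n) (S : BodySystem n)
    (hpos : ∀ i j, i < j → 0 < S.coeff i j) (hα : S.α < -1) :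
    (connectedComponentIn (S.configurations ℝ) '' S.configurations ℝ).ncard = n.factorial / 2 ∧
    ∀ V ∈ connectedComponentIn (S.configurations ℝ) '' S.configurations ℝ,
      HasFixedPointIndex (S.selfMap (𝕜 := ℝ)) V 1 := by
  have hn2 : 2 ≤ n := by omega
  refine ⟨S.ncard_components hn2, fun V hV => ?_⟩
  rw [S.components_eq_range hn2] at hV
  obtain ⟨σ, rfl⟩ := hV
  exact S.hasFixedPointIndex_cell hn2 hpos hα (BodySystem.permVec_ne σ)
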